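/- For an angle $\theta\in\mathbb R$ and an integer $m\ge 2$ put $|\phi_m(\theta)\rangle=\cos\theta\,|0\rangle^{\otimes m}+\sin\theta\,|1\rangle^{\otimes m}$; this is a generalized EPR state if $m=2$ and a generalized GHZ state if $m\ge 3$. Call $\theta$ nondegenerate if $\cos\theta\ne 0$ and $\sin\theta\neq 0$. For a bipartite pure state let ${\cal Q}(|\phi\rangle_{XY})=S(\rho_X)$ with $\rho_X={\rm Tr}_Y|\phi\rangle\langle\phi|$, where $S$ is either the von Neumann entropy $-{\rm Tr}(\rho\log_2\rho)$ or the R\'enyi entropy $\frac1{1-\alpha}\log_2{\rm Tr}(\rho^\alpha)$ for some $\alpha>0$, $\alpha\ne1$. For a bipartite density matrix let ${\cal Q}_{X|Y}(\rho)=\inf\sum_k p_k\,{\cal Q}(|\phi_k\rangle)$, the infimum being over all finite decompositions $\rho=\sum_k p_k|\phi_k\rangle\langle\phi_k|$ into pure states with probabilities $p_k$. (So ${\cal Q}$ is the entanglement of formation or the R\'enyi-$\alpha$ entanglement.) Consider a network of $n$ parties ${\sf A}_1,\dots,{\sf A}_n$ whose sources are finitely many states $|\phi_{m_k}(\theta_k)\rangle$,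 $m_k\ge2$. Each qubit of each source is held by one of the parties, or by nobody in the network and is then traced out (so that, for instance, two parties may share only the two-qubit marginal $\cos^2\theta|00\rangle\langle00|+\sin^2\theta|11\rangle\langle11|$ of a GHZ state). Each party ${\sf A}_i$ applies an arbitrary unitary to all the qubits that it holds. Let $\rho_{{\sf A}_1\cdots{\sf A}_n}$ be the resulting state and $\rho_{{\sf A}_i{\sf A}_j}$ its two-party marginals, and let $\overline{{\sf A}_i}$ stand for all parties except ${\sf A}_i$. Then for every $i$ $${\cal Q}_{{\sf A}_i|\overline{{\sf A}_i}}(\rho_{{\sf A}_1\cdots{\sf A}_n})\ \ge\ \sum_{j\ne i}{\cal Q}_{{\sf A}_i|{\sf A}_j}(\rho_{{\sf A}_i{\sf A}_j}).\qquad(*)$$ For a given $i$, equality holds in $(*)$ if and only if every generalized GHZ state of the network that has a nondegenerate angle, all of whose qubits are held by parties of the network, and at least one of whose qubits is held by ${\sf A}_i$, is held by at most two parties. In particular, if all generalized GHZ states of the network have nondegenerate angles and all their qubits are held by parties of the network, then equality holds in $(*)$ for all $i$ if and only if every generalized GHZ state is held by at most two parties. -/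

import Mathlib

noncomputable section

/-! ### Bipartite entanglement measures given by convex roofs -/

/-- The entropies used to measure entanglement: the von Neumann entropy, which gives the
entanglement of formation, and the Rényi entropies of order `α > 0`, `α ≠ 1`. -/
inductive EntropyKind : Type
  | vonNeumann : EntropyKind
  | renyi (α : ℝ) (pos : 0 < α) (ne_one : α ≠ 1) : EntropyKind

/-- The entropy (to base two) of a Hermitian matrix, in terms of its eigenvalues with
multiplicity: `-Tr (ρ log₂ ρ)` or `(1 - α)⁻¹ log₂ Tr (ρ ^ α)`. -/
def matrixEntropy (S : EntropyKind) {a : Type} [Fintype a] [DecidableEq a]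
    {ρ : Matrix a a ℂ} (h : ρ.IsHermitian) : ℝ :=
  match S with
  | .vonNeumann => -∑ x, h.eigenvalues x * Real.logb 2 (h.eigenvalues x)
  | .renyi α _ _ => (1 / (1 - α)) * Real.logb 2 (∑ x, h.eigenvalues x ^ α)

/-- The coefficient matrix of a bipartite vector. -/
def coeffMatrix {a b : Type} (φ : a × b → ℂ) : Matrix a b ℂ :=
  Matrix.of fun x y => φ (x, y)

/-- The entanglement of a bipartite pure state: the entropy of its reduced density matrix
`Tr_B |φ⟩⟨φ|` on the first factor. -/
def pureEntanglement (S : EntropyKind) {a b : Type} [Fintype a] [DecidableEq a] [Fintype b]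
    (φ : a × b → ℂ) : ℝ :=
  matrixEntropy S (Matrix.isHermitian_mul_conjTranspose_self (coeffMatrix φ))

/-- The values `∑ p_k E(φ_k)` over all finite decompositions `ρ = ∑ p_k |φ_k⟩⟨φ_k|` of `ρ` into
unit vectors with probabilities `p_k`. -/
def ensembleValues (S : EntropyKind) {a b : Type} [Fintype a] [DecidableEq a] [Fintype b]
    (ρ : Matrix (a × b) (a × b) ℂ) : Set ℝ :=
  {r | ∃ (K : ℕ) (p : Fin K → ℝ) (φ : Fin K → a × b → ℂ),
    (∀ k, 0 ≤ p k) ∧ ∑ k, p k = 1 ∧ (∀ k, ∑ x, ‖φ k x‖ ^ 2 = 1) ∧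
    ρ = ∑ k, (p k : ℂ) • Matrix.vecMulVec (φ k) (star (φ k)) ∧
    r = ∑ k, p k * pureEntanglement S (φ k)}

/-- The entanglement `𝒬_{A|B}(ρ)` of a bipartite density matrix (convex roof): the entanglement
of formation for the von Neumann entropy, the Rényi-`α` entanglement for the Rényi entropy. -/
def entanglement (S : EntropyKind) {a b : Type} [Fintype a] [DecidableEq a] [Fintype b]
    (ρ : Matrix (a × b) (a × b) ℂ) : ℝ :=
  sInf (ensembleValues S ρ)

/-! ### Marginals of a multipartite state -/

/-- A multipartite density matrix, viewed across the cut "party `i` versus all other parties". -/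
def cutState {n : ℕ} {H : Fin n → Type} (ρ : Matrix (∀ i, H i) (∀ i, H i) ℂ) (i : Fin n) :
    Matrix (H i × ∀ j : {j // j ≠ i}, H j) (H i × ∀ j : {j // j ≠ i}, H j) ℂ :=
  Matrix.reindex (Equiv.piSplitAt i H) (Equiv.piSplitAt i H) ρ

/-- The marginal of the parties `i` and `j ≠ i`: all other parties are traced out. -/
def pairState {n : ℕ} {H : Fin n → Type} [∀ i, Fintype (H i)]
    (ρ : Matrix (∀ i, H i) (∀ i, H i) ℂ) (i : Fin n) (j : {j // j ≠ i}) :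
    Matrix (H i × H j) (H i × H j) ℂ :=
  Matrix.of fun x y => ∑ z : (∀ k : {k : {k // k ≠ i} // k ≠ j}, H k),
    cutState ρ i (x.1, (Equiv.piSplitAt j fun k : {k // k ≠ i} => H k).symm (x.2, z))
      (y.1, (Equiv.piSplitAt j fun k : {k // k ≠ i} => H k).symm (y.2, z))

/-! ### Quantum networks -/

/-- The amplitudes of `cos θ |0…0⟩ + sin θ |1…1⟩` on `m` qubits: a generalized EPR state for
`m = 2`, a generalized GHZ state for `m ≥ 3`. -/
def ghzVector (θ : ℝ) (m : ℕ) (x : Fin m → Fin 2) : ℂ :=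
  (if ∀ q, x q = 0 then (Real.cos θ : ℂ) else 0) + (if ∀ q, x q = 1 then (Real.sin θ : ℂ) else 0)

/-- An `n`-party network of generalized EPR states and generalized GHZ states. Every qubit of every
source state is held by a party, or by nobody in the network (`none`); in the latter case the
parties hold only a marginal of that source state. -/
structure QNetwork (n : ℕ) where
  /-- the number of source states -/
  numSources : ℕ
  /-- the number of qubits of each source state: `2` for EPR, at least `3` for GHZ -/
  arity : Fin numSources → ℕ
  two_le_arity : ∀ k, 2 ≤ arity k
  /-- the angle of each source state -/
  angle : Fin numSources → ℝ
  /-- who holds which qubit -/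
  holder : ∀ k, Fin (arity k) → Option (Fin n)

namespace QNetwork

variable {n : ℕ} (N : QNetwork n)

/-- All qubits of all source states. -/
abbrev Qubit : Type := Σ k : Fin N.numSources, Fin (N.arity k)

/-- The computational basis of the qubits held by `p`. -/
abbrev Loc (p : Option (Fin n)) : Type := {q : N.Qubit // N.holder q.1 q.2 = p} → Fin 2

/-- The computational basis of the system of party `i`. -/
abbrev Party (i : Fin n) : Type := N.Loc (some i)

/-- The value of a qubit in a basis state of the parties and of the qubits outside the network. -/
def bit (f : ∀ i, N.Party i) (e : N.Loc none) (q : N.Qubit) : Fin 2 :=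
  match h : N.holder q.1 q.2 with
  | none => e ⟨q, h⟩
  | some i => f i ⟨q, h⟩

/-- The tensor product of all source states. -/
def sourceVector (f : ∀ i, N.Party i) (e : N.Loc none) : ℂ :=
  ∏ k, ghzVector (N.angle k) (N.arity k) fun q => N.bit f e ⟨k, q⟩

/-- The joint state of all parties before the local operations: the qubits outside the network
are traced out. -/
def sourceState : Matrix (∀ i, N.Party i) (∀ i, N.Party i) ℂ :=
  Matrix.of fun f g => ∑ e, N.sourceVector f e * star (N.sourceVector g e)

/-- The tensor product of local unitaries. -/
def localUnitary (U : ∀ i, Matrix.unitaryGroup (N.Party i) ℂ) :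
    Matrix (∀ i, N.Party i) (∀ i, N.Party i) ℂ :=
  Matrix.of fun f g => ∏ i, (U i : Matrix (N.Party i) (N.Party i) ℂ) (f i) (g i)

/-- The joint state of all parties after the local unitaries `U i`. -/
def state (U : ∀ i, Matrix.unitaryGroup (N.Party i) ℂ) :
    Matrix (∀ i, N.Party i) (∀ i, N.Party i) ℂ :=
  N.localUnitary U * N.sourceState * (N.localUnitary U).conjTranspose

/-- The parties which hold a qubit of the source state `k`. -/
def parties (k : Fin N.numSources) : Finset (Fin n) :=
  {i | ∃ q, N.holder k q = some i}

/-- The source state `k` is a generalized GHZ state. -/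
def IsGHZ (k : Fin N.numSources) : Prop := 3 ≤ N.arity k

/-- The angle of the source state `k` is not degenerate: it is not a product state. -/
def IsNondegenerate (k : Fin N.numSources) : Prop :=
  Real.cos (N.angle k) ≠ 0 ∧ Real.sin (N.angle k) ≠ 0

/-- All qubits of the source state `k` are held by parties of the network. -/
def IsInside (k : Fin N.numSources) : Prop := ∀ q, N.holder k q ≠ none

end QNetwork

end

/-! Both sides of the inequality are computed exactly, by one formula for a tripartition of the
qubits into sides 0, 1 and a traced-out side 2. Call a source crossing if it has qubits on sides 0
and 1 and none on side 2. The entanglement between sides 0 and 1 is then the sum, over crossing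
sources, of the entropy of `(cos² θ, sin² θ)` (`Tripartite.entanglement_eq`).

Convex roofs are not additive in general, so the formula needs the special form of the state. Fixing
the basis values `z` of side 2 writes the state as a mixture of vectors `Φ z`. Up to local
isometries, `Φ z` is a fixed vector `d` in Schmidt form (the crossing sources) tensored with a
vector `χ z`. Each `χ z` is a product across the cut, because a fixed GHZ qubit fixes all the
others. All the `Φ z` thus have the entropy of `d`, which bounds the convex roof from above.
Conversely, every vector of every decomposition lies in the span of the `Φ z`
(`mem_span_of_ensemble`), so it is `d` tensored with some `χ'`, possibly entangled. Entropy is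
additive on such tensor products and nonnegative (`pureEntanglement_schmidt`), so no decomposition
does better (`entanglement_eq_of_schmidt`).

The rest is counting. A source crosses the cut of party `i` against all others iff all its qubits
are held in the network, `i` holds one of them, and at least two parties are involved. It crosses
the pair `i`, `j` iff its qubits are all held in the network and its parties are exactly `i` and
`j`. Hence the gap in the inequality is the total entropy of the inside sources that involve `i` and
at least three parties. It is nonnegative, and it vanishes iff all these sources have degenerate
angles; each of them is automatically a GHZ state. -/

noncomputable section

/-! ### The entropy of a finite probability vector -/

/-- The entropy (to base two) of a finite probability vector. -/
def probEntropy (S : EntropyKind) {ι : Type} [Fintype ι] (d : ι → ℝ) : ℝ :=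
  match S with
  | .vonNeumann => -∑ x, d x * Real.logb 2 (d x)
  | .renyi α _ _ => (1 / (1 - α)) * Real.logb 2 (∑ x, d x ^ α)

lemma matrixEntropy_eq_probEntropy (S : EntropyKind) {a : Type} [Fintype a] [DecidableEq a]
    {ρ : Matrix a a ℂ} (h : ρ.IsHermitian) : matrixEntropy S h = probEntropy S h.eigenvalues := by
  cases S <;> rfl

/-- Entropies only depend on the sums `∑ f (d x)` over functions `f` with `f 0 = 0`. -/
lemma probEntropy_congr (S : EntropyKind) {ι κ : Type} [Fintype ι] [Fintype κ] {d : ι → ℝ}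
    {e : κ → ℝ} (h : ∀ f : ℝ → ℝ, f 0 = 0 → ∑ x, f (d x) = ∑ y, f (e y)) :
    probEntropy S d = probEntropy S e := by
  cases S with
  | vonNeumann => exact congrArg Neg.neg (h (fun x => x * Real.logb 2 x) (by simp))
  | renyi α pos ne =>
    exact congrArg (fun t => (1 / (1 - α)) * Real.logb 2 t)
      (h (fun x => x ^ α) (Real.zero_rpow pos.ne'))

lemma le_one_of_sum_eq_one {ι : Type} [Fintype ι] {d : ι → ℝ} (h0 : ∀ x, 0 ≤ d x)
    (h1 : ∑ x, d x = 1) (x : ι) : d x ≤ 1 :=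
  h1 ▸ Finset.single_le_sum (fun y _ => h0 y) (Finset.mem_univ x)

lemma sum_rpow_pos {ι : Type} [Fintype ι] {d : ι → ℝ} (h0 : ∀ x, 0 ≤ d x)
    (h1 : ∑ x, d x = 1) (α : ℝ) : 0 < ∑ x, d x ^ α := by
  obtain ⟨x, hx⟩ : ∃ x, 0 < d x := by
    by_contra! h
    have : ∑ x, d x ≤ 0 := Finset.sum_nonpos fun x _ => h x
    linarith
  exact Finset.sum_pos' (fun y _ => Real.rpow_nonneg (h0 y) α)
    ⟨x, Finset.mem_univ x, Real.rpow_pos_of_pos hx α⟩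

lemma rpow_le_self_of_one_lt {x α : ℝ} (h0 : 0 ≤ x) (h1 : x ≤ 1) (hα : 1 < α) : x ^ α ≤ x := by
  rcases h0.eq_or_lt with rfl | h
  · rw [Real.zero_rpow (by linarith)]
  · simpa using Real.rpow_le_rpow_of_exponent_ge h h1 hα.le

lemma self_le_rpow_of_lt_one {x α : ℝ} (h0 : 0 ≤ x) (h1 : x ≤ 1) (hα : α < 1) (hα0 : 0 < α) :
    x ≤ x ^ α := by
  rcases h0.eq_or_lt with rfl | h
  · rw [Real.zero_rpow hα0.ne']
  · simpa using Real.rpow_le_rpow_of_exponent_ge h h1 hα.le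

/-- On `[0, 1]` the power `x ^ α` lies above `x` for `α < 1` and below it for `α > 1`. The logarithm
of the power sum therefore changes sign together with the factor `1 / (1 - α)`. -/
lemma probEntropy_nonneg (S : EntropyKind) {ι : Type} [Fintype ι] {d : ι → ℝ}
    (h0 : ∀ x, 0 ≤ d x) (h1 : ∑ x, d x = 1) : 0 ≤ probEntropy S d := by
  have hle := le_one_of_sum_eq_one h0 h1
  cases S with
  | vonNeumann =>
    refine neg_nonneg.2 (Finset.sum_nonpos fun x _ => ?_)
    exact mul_nonpos_of_nonneg_of_nonpos (h0 x)
      (Real.logb_nonpos one_lt_two (h0 x) (hle x))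
  | renyi α pos ne =>
    rcases ne.lt_or_gt with h | h
    · refine mul_nonneg (by rw [one_div, inv_nonneg]; linarith)
        (Real.logb_nonneg one_lt_two ?_)
      rw [← h1]
      exact Finset.sum_le_sum fun x _ => self_le_rpow_of_lt_one (h0 x) (hle x) h pos
    · refine mul_nonneg_of_nonpos_of_nonpos (by rw [one_div, inv_nonpos]; linarith)
        (Real.logb_nonpos one_lt_two (sum_rpow_pos h0 h1 α).le ?_)
      rw [← h1]
      exact Finset.sum_le_sum fun x _ => rpow_le_self_of_one_lt (h0 x) (hle x) h

lemma probEntropy_pos (S : EntropyKind) {ι : Type} [Fintype ι] {d : ι → ℝ}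
    (h0 : ∀ x, 0 ≤ d x) (h1 : ∑ x, d x = 1) {x : ι} (hx0 : 0 < d x) (hx1 : d x < 1) :
    0 < probEntropy S d := by
  have hle := le_one_of_sum_eq_one h0 h1
  cases S with
  | vonNeumann =>
    refine neg_pos.2 (Finset.sum_neg' (fun x _ => ?_) ⟨x, Finset.mem_univ x, ?_⟩)
    · exact mul_nonpos_of_nonneg_of_nonpos (h0 x)
        (Real.logb_nonpos one_lt_two (h0 x) (hle x))
    · exact mul_neg_of_pos_of_neg hx0 (Real.logb_neg one_lt_two hx0 hx1)
  | renyi α pos ne =>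
    rcases ne.lt_or_gt with h | h
    · refine mul_pos (by rw [one_div, inv_pos]; linarith) (Real.logb_pos one_lt_two ?_)
      rw [← h1]
      exact Finset.sum_lt_sum (fun x _ => self_le_rpow_of_lt_one (h0 x) (hle x) h pos)
        ⟨x, Finset.mem_univ x, by simpa using Real.rpow_lt_rpow_of_exponent_gt hx0 hx1 h⟩
    · refine mul_pos_of_neg_of_neg (by rw [one_div, inv_lt_zero]; linarith)
        (Real.logb_neg one_lt_two (sum_rpow_pos h0 h1 α) ?_)
      rw [← h1]
      exact Finset.sum_lt_sum (fun x _ => rpow_le_self_of_one_lt (h0 x) (hle x) h)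
        ⟨x, Finset.mem_univ x, by simpa using Real.rpow_lt_rpow_of_exponent_gt hx0 hx1 h⟩

lemma probEntropy_eq_zero (S : EntropyKind) {ι : Type} [Fintype ι] {d : ι → ℝ}
    (h1 : ∑ x, d x = 1) (h : ∀ x, d x = 0 ∨ d x = 1) : probEntropy S d = 0 := by
  cases S with
  | vonNeumann =>
    refine neg_eq_zero.2 (Finset.sum_eq_zero fun x _ => ?_)
    rcases h x with h | h <;> simp [h]
  | renyi α pos ne =>
    have : ∑ x, d x ^ α = 1 := by
      rw [← h1]
      refine Finset.sum_congr rfl fun x _ => ?_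
      rcases h x with h | h <;> simp [h, Real.zero_rpow pos.ne']
    simp [probEntropy, this]

lemma probEntropy_mul (S : EntropyKind) {ι κ : Type} [Fintype ι] [Fintype κ] {d : ι → ℝ}
    {e : κ → ℝ} (hd0 : ∀ x, 0 ≤ d x) (hd1 : ∑ x, d x = 1) (he0 : ∀ x, 0 ≤ e x)
    (he1 : ∑ x, e x = 1) :
    probEntropy S (fun p : ι × κ => d p.1 * e p.2) = probEntropy S d + probEntropy S e := by
  cases S with
  | vonNeumann =>
    have key : ∀ x y, d x * e y * Real.logb 2 (d x * e y) =
        d x * Real.logb 2 (d x) * e y + d x * (e y * Real.logb 2 (e y)) := by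
      intro x y
      -- The logarithm of a product splits only for nonzero factors; zero weights contribute nothing
      -- to either side.
      by_cases hx : d x = 0
      · simp [hx]
      by_cases hy : e y = 0
      · simp [hy]
      rw [Real.logb_mul hx hy]
      ring
    simp only [probEntropy, Fintype.sum_prod_type, key, Finset.sum_add_distrib, ← Finset.mul_sum,
      he1, mul_one]
    rw [← Finset.sum_mul, hd1]
    ring
  | renyi α pos ne =>
    simp only [probEntropy, Fintype.sum_prod_type, Real.mul_rpow (hd0 _) (he0 _),
      ← Finset.mul_sum]
    rw [← Finset.sum_mul, Real.logb_mul (sum_rpow_pos hd0 hd1 α).ne' (sum_rpow_pos he0 he1 α).ne']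
    ring

/-- Under a product distribution, the expectation of a function of one coordinate is its expectation
under that marginal. The function is absorbed into the `j`-th factor before exchanging product and
sum. -/
lemma sum_pi_prod_mul {κ β : Type} [Fintype κ] [DecidableEq κ] [Fintype β] {d : κ → β → ℝ}
    (h1 : ∀ k, ∑ s, d k s = 1) (j : κ) (g : β → ℝ) :
    ∑ p : κ → β, (∏ k, d k (p k)) * g (p j) = ∑ s, d j s * g s := by
  have h := Fintype.prod_sum (fun k s => d k s * if k = j then g s else 1)
  have h2 : ∀ p : κ → β, ∏ k, (d k (p k) * if k = j then g (p k) else 1) =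
      (∏ k, d k (p k)) * g (p j) := by
    intro p
    rw [Finset.prod_mul_distrib, Finset.prod_ite_eq' Finset.univ j fun k => g (p k)]
    simp
  simp only [h2] at h
  rw [← h, Fintype.prod_eq_single j]
  · simp
  · intro k hk
    simp [hk, h1]

lemma sum_pi_prod {κ β : Type} [Fintype κ] [DecidableEq κ] [Fintype β] {d : κ → β → ℝ}
    (h1 : ∀ k, ∑ s, d k s = 1) : ∑ p : κ → β, ∏ k, d k (p k) = 1 := by
  rw [← Fintype.prod_sum (fun k s => d k s)]
  simp [h1]

lemma probEntropy_pi (S : EntropyKind) {κ β : Type} [Fintype κ] [DecidableEq κ] [Fintype β]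
    {d : κ → β → ℝ} (h0 : ∀ k s, 0 ≤ d k s) (h1 : ∀ k, ∑ s, d k s = 1) :
    probEntropy S (fun p : κ → β => ∏ k, d k (p k)) = ∑ k, probEntropy S (d k) := by
  cases S with
  | vonNeumann =>
    have key : ∀ p : κ → β, (∏ k, d k (p k)) * Real.logb 2 (∏ k, d k (p k)) =
        ∑ j, (∏ k, d k (p k)) * Real.logb 2 (d j (p j)) := by
      intro p
      by_cases h : ∏ k, d k (p k) = 0
      · simp [h]
      · rw [Real.logb_prod _ _ fun k _ => Finset.prod_ne_zero_iff.1 h k (Finset.mem_univ k),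
          Finset.mul_sum]
    simp only [probEntropy, key]
    rw [Finset.sum_comm, ← Finset.sum_neg_distrib]
    exact Finset.sum_congr rfl fun j _ =>
      congrArg Neg.neg (sum_pi_prod_mul h1 j fun s => Real.logb 2 (d j s))
  | renyi α pos ne =>
    simp only [probEntropy, ← Real.finsetProd_rpow _ _ (fun k _ => h0 k _)]
    rw [← Fintype.prod_sum (fun k s => d k s ^ α),
      Real.logb_prod _ _ fun k _ => (sum_rpow_pos (h0 k) (h1 k) α).ne', Finset.mul_sum]

/-! ### Entanglement of pure states -/

/-- The characteristic polynomials of `A * B` and `B * A` agree up to powers of `X`, so the spectrum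
of `ρ` is `d` up to zeros, which `f` ignores. This gives entropies from any isometric
diagonalisation, with no ordering of eigenvalues. -/
lemma sum_eigenvalues_of_isometry {a t : Type} [Fintype a] [DecidableEq a] [Fintype t]
    [DecidableEq t] {ρ : Matrix a a ℂ} (h : ρ.IsHermitian) {W : Matrix a t ℂ}
    (hW : W.conjTranspose * W = 1) {d : t → ℝ}
    (hρ : ρ = W * Matrix.diagonal (fun x => (d x : ℂ)) * W.conjTranspose)
    (f : ℝ → ℝ) (hf : f 0 = 0) : ∑ x, f (h.eigenvalues x) = ∑ y, f (d y) := by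
  have hc := Matrix.charpoly_mul_comm' (W * Matrix.diagonal (fun x => (d x : ℂ))) W.conjTranspose
  rw [← hρ, ← Matrix.mul_assoc, hW, Matrix.one_mul, Matrix.charpoly_diagonal] at hc
  have hne : (∏ i, (Polynomial.X - Polynomial.C (d i : ℂ))) ≠ 0 :=
    (Polynomial.monic_prod_of_monic _ _ fun i _ => Polynomial.monic_X_sub_C _).ne_zero
  have hX : ∀ k : ℕ, (Polynomial.X ^ k : Polynomial ℂ) ≠ 0 := fun k =>
    pow_ne_zero k Polynomial.X_ne_zero
  have hr := congrArg Polynomial.roots hc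
  rw [Polynomial.roots_mul (mul_ne_zero (hX _) ρ.charpoly_monic.ne_zero),
    Polynomial.roots_mul (mul_ne_zero (hX _) hne), h.roots_charpoly_eq_eigenvalues,
    Polynomial.roots_prod _ _ hne] at hr
  have hs := congrArg (fun s => (s.map fun z : ℂ => f z.re).sum) hr
  simpa [hf, Multiset.map_nsmul, Multiset.sum_nsmul, Multiset.bind_singleton,
    Function.comp_def] using hs

lemma conjTranspose_mul_self_submatrix {a b t : Type} [Fintype a] [DecidableEq t] [Fintype b]
    [DecidableEq b] {U : Matrix a b ℂ} (hU : U.conjTranspose * U = 1) {J : t → b}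
    (hJ : Function.Injective J) :
    (U.submatrix id J).conjTranspose * U.submatrix id J = 1 := by
  rw [Matrix.conjTranspose_submatrix, ← Matrix.submatrix_mul _ _ J id J Function.bijective_id,
    hU, Matrix.submatrix_one J hJ]

section

variable {a b a' b' s : Type} [Fintype a] [Fintype b] [Fintype a'] [Fintype b'] [Fintype s]
  [DecidableEq a] [DecidableEq a'] [DecidableEq b'] [DecidableEq s]

set_option linter.unusedSectionVars false

lemma trace_coeffMatrix_mul_conjTranspose (φ : a × b → ℂ) :
    (coeffMatrix φ * (coeffMatrix φ).conjTranspose).trace = ((∑ x, ‖φ x‖ ^ 2 : ℝ) : ℂ) := by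
  simp [Matrix.trace, Matrix.mul_apply, coeffMatrix, Fintype.sum_prod_type, Complex.mul_conj,
    Complex.normSq_eq_norm_sq]

open scoped ComplexOrder in
/-- The eigenvalues of a reduced density matrix form a probability vector. -/
lemma eigenvalues_reduced_nonneg (φ : a × b → ℂ) (x : a) :
    0 ≤ (Matrix.isHermitian_mul_conjTranspose_self (coeffMatrix φ)).eigenvalues x :=
  (Matrix.posSemidef_self_mul_conjTranspose (coeffMatrix φ)).eigenvalues_nonneg x

lemma sum_eigenvalues_reduced (φ : a × b → ℂ) (h : ∑ x, ‖φ x‖ ^ 2 = 1) :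
    ∑ x, (Matrix.isHermitian_mul_conjTranspose_self (coeffMatrix φ)).eigenvalues x = 1 := by
  have := (Matrix.isHermitian_mul_conjTranspose_self (coeffMatrix φ)).trace_eq_sum_eigenvalues
  rw [trace_coeffMatrix_mul_conjTranspose, h] at this
  simpa using (congrArg Complex.re this).symm

lemma pureEntanglement_nonneg (S : EntropyKind) (φ : a × b → ℂ) (h : ∑ x, ‖φ x‖ ^ 2 = 1) :
    0 ≤ pureEntanglement S φ := by
  rw [pureEntanglement, matrixEntropy_eq_probEntropy]
  exact probEntropy_nonneg S (eigenvalues_reduced_nonneg φ) (sum_eigenvalues_reduced φ h)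

/-- A product vector is not entangled. -/
lemma pureEntanglement_product (S : EntropyKind) (f : a → ℂ) (g : b → ℂ)
    (h : ∑ x : a × b, ‖f x.1 * g x.2‖ ^ 2 = 1) :
    pureEntanglement S (fun x : a × b => f x.1 * g x.2) = 0 := by
  set F : ℝ := ∑ x, ‖f x‖ ^ 2 with hF
  set G : ℝ := ∑ y, ‖g y‖ ^ 2 with hG
  have hFG : F * G = 1 := by
    rw [← h, Fintype.sum_prod_type, hF, hG, Finset.sum_mul_sum]
    simp [mul_pow]
  have hF0 : 0 ≤ F := Finset.sum_nonneg fun _ _ => sq_nonneg _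
  have hFne : F ≠ 0 := left_ne_zero_of_mul_eq_one hFG
  -- The reduced matrix has rank one with eigenvector `f`. The factor `r` normalises `f`, and `r * r
  -- = G` because `F * G = 1`.
  set r : ℝ := (Real.sqrt F)⁻¹ with hr
  have hr2 : r * r * F = 1 := by
    rw [hr, ← mul_inv, Real.mul_self_sqrt hF0, inv_mul_cancel₀ hFne]
  have hfs : ∑ x, star (f x) * f x = (F : ℂ) := by
    rw [hF]; push_cast
    refine Finset.sum_congr rfl fun x _ => ?_
    rw [mul_comm, Complex.star_def, Complex.mul_conj, Complex.normSq_eq_norm_sq]; push_cast; rfl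
  have hgs : ∑ y, g y * star (g y) = (G : ℂ) := by
    rw [hG]; push_cast
    refine Finset.sum_congr rfl fun x _ => ?_
    rw [Complex.star_def, Complex.mul_conj, Complex.normSq_eq_norm_sq]; push_cast; rfl
  have hrG : (r : ℂ) * r = G := by
    have : r * r = G := by
      have := hFG; have := hr2
      apply mul_right_cancel₀ hFne
      linarith
    exact_mod_cast this
  rw [pureEntanglement, matrixEntropy_eq_probEntropy,
    probEntropy_congr S (sum_eigenvalues_of_isometry _
      (W := Matrix.of fun x (_ : Unit) => (r : ℂ) * f x) (d := fun _ => 1) ?_ ?_)]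
  · exact probEntropy_eq_zero S (by simp) (by simp)
  · ext x y
    have : ∑ x, (r : ℂ) * (starRingEnd ℂ) (f x) * (r * f x) = ((r * r * F : ℝ) : ℂ) := by
      push_cast
      rw [← hfs, Finset.mul_sum]
      exact Finset.sum_congr rfl fun x _ => by rw [Complex.star_def]; ring
    simp [Matrix.mul_apply, this, hr2]
  · ext x x'
    have : ∑ y, f x * g y * (starRingEnd ℂ (g y) * starRingEnd ℂ (f x')) =
        r * f x * (starRingEnd ℂ (f x') * r) := by
      rw [show (r : ℂ) * f x * (starRingEnd ℂ (f x') * r) = r * r * (f x * starRingEnd ℂ (f x'))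
        by ring, hrG, ← hgs, Finset.sum_mul]
      exact Finset.sum_congr rfl fun x _ => by rw [Complex.star_def]; ring
    simpa [Matrix.mul_apply, coeffMatrix, mul_comm, mul_left_comm] using this

open scoped Kronecker

/-- The reduced density matrix of a tensor product of a vector in Schmidt form and a vector `χ`,
embedded by local isometries. -/
lemma schmidt_mul_conjTranspose {F : Matrix a (s × a') ℂ} {G : Matrix b (s × b') ℂ}
    (hG : G.conjTranspose * G = 1) (d : s → ℂ) (χ : Matrix a' b' ℂ) :
    (F * (Matrix.diagonal d ⊗ₖ χ) * G.transpose) *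
        (F * (Matrix.diagonal d ⊗ₖ χ) * G.transpose).conjTranspose =
      F * (Matrix.diagonal (fun p => ((‖d p‖ ^ 2 : ℝ) : ℂ)) ⊗ₖ (χ * χ.conjTranspose)) *
        F.conjTranspose := by
  have hG' : G.transpose * G.transpose.conjTranspose = 1 := by
    rw [show G.transpose.conjTranspose = G.conjTranspose.transpose from rfl, ← Matrix.transpose_mul, hG, Matrix.transpose_one]
  have hD : Matrix.diagonal (fun p => ((‖d p‖ ^ 2 : ℝ) : ℂ)) =
      Matrix.diagonal d * (Matrix.diagonal d).conjTranspose := by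
    rw [Matrix.diagonal_conjTranspose, Matrix.diagonal_mul_diagonal]
    congr 1
    ext p
    simp [Complex.mul_conj, Complex.normSq_eq_norm_sq]
  rw [hD, Matrix.mul_kronecker_mul, Matrix.conjTranspose_mul, Matrix.conjTranspose_mul,
    Matrix.conjTranspose_kronecker]
  simp only [Matrix.mul_assoc]
  rw [← Matrix.mul_assoc G.transpose, hG', Matrix.one_mul]

/-- The squared norm is the trace of the reduced matrix. The isometry `F` drops out by cyclicity and
the Schmidt factor has trace one. -/
lemma norm_sq_schmidt {F : Matrix a (s × a') ℂ} {G : Matrix b (s × b') ℂ}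
    (hF : F.conjTranspose * F = 1) (hG : G.conjTranspose * G = 1) {d : s → ℂ}
    (hd : ∑ p, ‖d p‖ ^ 2 = 1) {φ : a × b → ℂ} {χ : a' × b' → ℂ}
    (hφ : coeffMatrix φ = F * (Matrix.diagonal d ⊗ₖ coeffMatrix χ) * G.transpose) :
    ∑ x, ‖φ x‖ ^ 2 = ∑ x, ‖χ x‖ ^ 2 := by
  have h := trace_coeffMatrix_mul_conjTranspose φ
  rw [hφ, schmidt_mul_conjTranspose hG, Matrix.trace_mul_comm, ← Matrix.mul_assoc, hF,
    Matrix.one_mul, Matrix.trace_kronecker, trace_coeffMatrix_mul_conjTranspose,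
    Matrix.trace_diagonal, ← Complex.ofReal_sum, hd] at h
  simpa using (Complex.ofReal_injective (by simpa using h)).symm

/-- The entanglement is additive on tensor products of a vector in Schmidt form and a vector `χ`,
and invariant under local isometries. -/
lemma pureEntanglement_schmidt (S : EntropyKind) {F : Matrix a (s × a') ℂ}
    {G : Matrix b (s × b') ℂ} (hF : F.conjTranspose * F = 1) (hG : G.conjTranspose * G = 1)
    {d : s → ℂ} (hd : ∑ p, ‖d p‖ ^ 2 = 1) {φ : a × b → ℂ} {χ : a' × b' → ℂ}
    (hχ : ∑ x, ‖χ x‖ ^ 2 = 1)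
    (hφ : coeffMatrix φ = F * (Matrix.diagonal d ⊗ₖ coeffMatrix χ) * G.transpose) :
    pureEntanglement S φ = probEntropy S (fun p => ‖d p‖ ^ 2) + pureEntanglement S χ := by
  set hσ := Matrix.isHermitian_mul_conjTranspose_self (coeffMatrix χ)
  -- `V` diagonalises the reduced matrix of `χ`, so `F * (1 ⊗ₖ V)` diagonalises that of `φ`, with
  -- the products of both spectra as eigenvalues.
  set V : Matrix a' a' ℂ := hσ.eigenvectorUnitary.1
  have hV : V.conjTranspose * V = 1 := Unitary.coe_star_mul_self hσ.eigenvectorUnitary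
  have hsp : coeffMatrix χ * (coeffMatrix χ).conjTranspose =
      V * Matrix.diagonal (fun x => (hσ.eigenvalues x : ℂ)) * V.conjTranspose := by
    have := hσ.spectral_theorem
    rw [Unitary.conjStarAlgAut_apply] at this
    exact this
  rw [pureEntanglement, matrixEntropy_eq_probEntropy, pureEntanglement,
    matrixEntropy_eq_probEntropy, ← probEntropy_mul S (fun p => sq_nonneg _) hd
      (eigenvalues_reduced_nonneg χ) (sum_eigenvalues_reduced χ hχ)]
  refine probEntropy_congr S (sum_eigenvalues_of_isometry _
    (W := F * ((1 : Matrix s s ℂ) ⊗ₖ V)) ?_ ?_)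
  · rw [Matrix.conjTranspose_mul, Matrix.mul_assoc, ← Matrix.mul_assoc F.conjTranspose, hF,
      Matrix.one_mul, Matrix.conjTranspose_kronecker, ← Matrix.mul_kronecker_mul, hV]
    simp
  · have hdiag : Matrix.diagonal (fun x : s × a' =>
        ((‖d x.1‖ ^ 2 * hσ.eigenvalues x.2 : ℝ) : ℂ)) =
        Matrix.diagonal (fun p => ((‖d p‖ ^ 2 : ℝ) : ℂ)) ⊗ₖ
          Matrix.diagonal (fun x => (hσ.eigenvalues x : ℂ)) := by
      rw [Matrix.diagonal_kronecker_diagonal]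
      simp
    rw [hφ, schmidt_mul_conjTranspose hG]
    -- The eigenvalues are defined from the very matrix that `hsp` rewrites; making them opaque
    -- protects them from the rewrite.
    generalize hσ.eigenvalues = lam at hdiag hsp ⊢
    rw [hdiag, hsp, Matrix.conjTranspose_mul,
      Matrix.conjTranspose_kronecker]
    simp only [Matrix.mul_assoc]
    congr 1
    rw [← Matrix.mul_assoc (1 ⊗ₖ V), ← Matrix.mul_assoc (1 ⊗ₖ V * _), ← Matrix.mul_kronecker_mul,
      ← Matrix.mul_kronecker_mul]
    simp [Matrix.mul_assoc]

end

/-! ### Convex roofs -/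

lemma mem_ensembleValues_of_fintype (S : EntropyKind) {a b c : Type} [Fintype a] [DecidableEq a]
    [Fintype b] [Fintype c] {ρ : Matrix (a × b) (a × b) ℂ} (p : c → ℝ) (φ : c → a × b → ℂ)
    (hp : ∀ z, 0 ≤ p z) (hp1 : ∑ z, p z = 1) (hφ : ∀ z, ∑ x, ‖φ z x‖ ^ 2 = 1)
    (hρ : ρ = ∑ z, (p z : ℂ) • Matrix.vecMulVec (φ z) (star (φ z))) :
    ∑ z, p z * pureEntanglement S (φ z) ∈ ensembleValues S ρ := by
  let e := (Fintype.equivFin c).symm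
  refine ⟨Fintype.card c, fun k => p (e k), fun k => φ (e k), fun k => hp _, ?_, fun k => hφ _,
    ?_, ?_⟩
  · rw [← hp1, e.sum_comp p]
  · rw [hρ, e.sum_comp fun z => (p z : ℂ) • Matrix.vecMulVec (φ z) (star (φ z))]
  · rw [e.sum_comp fun z => p z * pureEntanglement S (φ z)]

lemma functional_vecMulVec_sum {ι : Type} [Fintype ι] (g v : ι → ℂ) :
    ∑ x, ∑ y, g x * Matrix.vecMulVec v (star v) x y * star (g y) =
      ((‖∑ x, g x * v x‖ ^ 2 : ℝ) : ℂ) := by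
  rw [← Complex.normSq_eq_norm_sq, ← Complex.mul_conj, map_sum, Finset.sum_mul_sum]
  refine Finset.sum_congr rfl fun x _ => Finset.sum_congr rfl fun y _ => ?_
  simp only [Matrix.vecMulVec_apply, Pi.star_apply, Complex.star_def, map_mul]
  ring

/-- The vectors of an ensemble lie in the span of the vectors of any other ensemble for the same
density matrix. -/
lemma mem_span_of_ensemble {ι κ c : Type} [Fintype ι] [Fintype κ] [Fintype c]
    {p : κ → ℝ} (hp : ∀ k, 0 ≤ p k) {φ : κ → ι → ℂ} {Φ : c → ι → ℂ}
    (h : ∑ z, Matrix.vecMulVec (Φ z) (star (Φ z)) =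
      ∑ k, (p k : ℂ) • Matrix.vecMulVec (φ k) (star (φ k))) {k : κ} (hk : p k ≠ 0) :
    φ k ∈ Submodule.span ℂ (Set.range Φ) := by
  classical
  by_contra hnot
  -- Separate `φ k` from the span by a functional `f` and evaluate the quadratic form of `f` on both
  -- ensembles. One gives zero, the other a sum of nonnegative terms whose `k`-th term is positive.
  obtain ⟨f, hf, hle⟩ := Submodule.exists_le_ker_of_notMem hnot
  set g : ι → ℂ := fun x => f (Pi.single x 1) with hg
  have hfg : ∀ v, f v = ∑ x, g x * v x := fun v => by
    rw [LinearMap.pi_apply_eq_sum_univ f v]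
    refine Finset.sum_congr rfl fun x _ => ?_
    rw [smul_eq_mul, mul_comm, hg]
    congr 2
    ext j
    simp [Pi.single_apply, eq_comm]
  have hq : ∑ z, ‖f (Φ z)‖ ^ 2 = ∑ k, p k * ‖f (φ k)‖ ^ 2 := by
    have h2 := congrArg (fun M : Matrix ι ι ℂ => ∑ x, ∑ y, g x * M x y * star (g y)) h
    simp only [Matrix.sum_apply, Matrix.smul_apply, Finset.mul_sum, Finset.sum_mul,
      smul_eq_mul] at h2
    have e1 : ∀ M : c → Matrix ι ι ℂ, ∑ x, ∑ y, ∑ z, g x * M z x y * star (g y) =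
        ∑ z, ∑ x, ∑ y, g x * M z x y * star (g y) := fun M => by
      rw [Finset.sum_comm]
      simp_rw [Finset.sum_comm (s := (Finset.univ : Finset ι)) (t := (Finset.univ : Finset c))]
      exact Finset.sum_congr rfl fun _ _ => Finset.sum_comm
    have e2 : ∀ M : κ → Matrix ι ι ℂ,
        ∑ x, ∑ y, ∑ k, g x * ((p k : ℂ) * M k x y) * star (g y) =
        ∑ k, (p k : ℂ) * ∑ x, ∑ y, g x * M k x y * star (g y) := fun M => by
      simp_rw [Finset.mul_sum]
      rw [Finset.sum_comm]
      simp_rw [Finset.sum_comm (s := (Finset.univ : Finset ι)) (t := (Finset.univ : Finset κ))]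
      refine Finset.sum_congr rfl fun _ _ => ?_
      rw [Finset.sum_comm]
      exact Finset.sum_congr rfl fun _ _ => Finset.sum_congr rfl fun _ _ => by ring
    rw [e1 fun z => Matrix.vecMulVec (Φ z) (star (Φ z)),
      e2 fun k => Matrix.vecMulVec (φ k) (star (φ k))] at h2
    simp only [functional_vecMulVec_sum, ← hfg] at h2
    exact_mod_cast h2
  have hz : ∑ z, ‖f (Φ z)‖ ^ 2 = 0 := Finset.sum_eq_zero fun z _ => by
    have : f (Φ z) = 0 := hle (Submodule.subset_span ⟨z, rfl⟩)
    simp [this]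
  rw [hz] at hq
  have := (Finset.sum_eq_zero_iff_of_nonneg fun k _ =>
    mul_nonneg (hp k) (sq_nonneg ‖f (φ k)‖)).1 hq.symm k (Finset.mem_univ k)
  rcases mul_eq_zero.1 this with h0 | h0
  · exact hk h0
  · exact hf (by simpa using h0)

open scoped Kronecker in
/-- The entanglement of a mixture of vectors which are tensor products of one vector in Schmidt
form and product vectors. -/
theorem entanglement_eq_of_schmidt (S : EntropyKind) {a b a' b' s c : Type} [Fintype a] [Fintype b]
    [Fintype a'] [Fintype b'] [Fintype s] [Fintype c] [DecidableEq a] [DecidableEq a']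
    [DecidableEq b'] [DecidableEq s] {F : Matrix a (s × a') ℂ} {G : Matrix b (s × b') ℂ}
    (hF : F.conjTranspose * F = 1) (hG : G.conjTranspose * G = 1) {d : s → ℂ}
    (hd : ∑ p, ‖d p‖ ^ 2 = 1) {Φ : c → a × b → ℂ} {χ : c → a' × b' → ℂ}
    (hΦ : ∀ z, coeffMatrix (Φ z) = F * (Matrix.diagonal d ⊗ₖ coeffMatrix (χ z)) * G.transpose)
    (hprod : ∀ z, ∃ (f : a' → ℂ) (g : b' → ℂ), ∀ x, χ z x = f x.1 * g x.2)
    (hχ : ∑ z, ∑ x, ‖χ z x‖ ^ 2 = 1) {ρ : Matrix (a × b) (a × b) ℂ}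
    (hρ : ρ = ∑ z, Matrix.vecMulVec (Φ z) (star (Φ z))) :
    entanglement S ρ = probEntropy S (fun p => ‖d p‖ ^ 2) := by
  have hnorm : ∀ z, ∑ x, ‖Φ z x‖ ^ 2 = ∑ x, ‖χ z x‖ ^ 2 := fun z => norm_sq_schmidt hF hG hd (hΦ z)
  have hscale : ∀ z, ∑ x, ‖χ z x‖ ^ 2 ≠ 0 → ∃ φ : a × b → ℂ, ∑ x, ‖φ x‖ ^ 2 = 1 ∧
      ((∑ x, ‖χ z x‖ ^ 2 : ℝ) : ℂ) • Matrix.vecMulVec φ (star φ) =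
        Matrix.vecMulVec (Φ z) (star (Φ z)) ∧
      pureEntanglement S φ = probEntropy S (fun p => ‖d p‖ ^ 2) := by
    intro z hz
    set q := ∑ x, ‖χ z x‖ ^ 2 with hq
    have hq0 : 0 ≤ q := Finset.sum_nonneg fun _ _ => sq_nonneg _
    set r : ℝ := (Real.sqrt q)⁻¹ with hr
    have hr2 : r ^ 2 * q = 1 := by
      rw [hr, inv_pow, Real.sq_sqrt hq0, inv_mul_cancel₀ hz]
    have hr0 : 0 ≤ r := inv_nonneg.2 (Real.sqrt_nonneg q)
    have hrn : ∀ w : ℂ, ‖(r : ℂ) * w‖ ^ 2 = r ^ 2 * ‖w‖ ^ 2 := fun w => by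
      rw [norm_mul, mul_pow, Complex.norm_real, Real.norm_of_nonneg hr0]
    obtain ⟨f, g, hfg⟩ := hprod z
    have hu : ∑ x : a' × b', ‖(r * f x.1) * g x.2‖ ^ 2 = 1 := by
      simp only [mul_assoc, hrn, ← Finset.mul_sum, ← hfg]
      exact hr2
    refine ⟨fun x => r * Φ z x, ?_, ?_, ?_⟩
    · simp only [hrn, ← Finset.mul_sum, hnorm z]
      exact hr2
    · ext x y
      have hr2' : (r : ℂ) ^ 2 * q = 1 := by exact_mod_cast hr2
      simp only [Matrix.smul_apply, Matrix.vecMulVec_apply, Pi.star_apply, smul_eq_mul, star_mul',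
        Complex.star_def, Complex.conj_ofReal]
      linear_combination (Φ z x * (starRingEnd ℂ) (Φ z y)) * hr2'
    · rw [pureEntanglement_schmidt S hF hG hd (χ := fun x => (r * f x.1) * g x.2) hu,
        pureEntanglement_product S (fun x => r * f x) g hu, add_zero]
      have h1 : coeffMatrix (fun x => (r : ℂ) * Φ z x) = (r : ℂ) • coeffMatrix (Φ z) := rfl
      have h2 : coeffMatrix (fun x : a' × b' => (r * f x.1) * g x.2) =
          (r : ℂ) • coeffMatrix (χ z) := by
        ext x y
        simp [coeffMatrix, hfg, mul_assoc]
      rw [h1, h2, hΦ, Matrix.kronecker_smul, Matrix.mul_smul, Matrix.smul_mul]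
  -- Upper bound: the normalised `Φ z`, weighted by their squared norms, form an ensemble of
  -- constant entanglement.
  have hmem : probEntropy S (fun p => ‖d p‖ ^ 2) ∈ ensembleValues S ρ := by
    obtain ⟨z₀, hz₀⟩ : ∃ z, ∑ x, ‖χ z x‖ ^ 2 ≠ 0 := by
      by_contra! h
      simp [h] at hχ
    have hall : ∀ z, ∃ φ : a × b → ℂ, ∑ x, ‖φ x‖ ^ 2 = 1 ∧
        ((∑ x, ‖χ z x‖ ^ 2 : ℝ) : ℂ) • Matrix.vecMulVec φ (star φ) =
          Matrix.vecMulVec (Φ z) (star (Φ z)) ∧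
        pureEntanglement S φ = probEntropy S (fun p => ‖d p‖ ^ 2) := by
      intro z
      by_cases hz : ∑ x, ‖χ z x‖ ^ 2 = 0
      -- A vanishing `Φ z` cannot be normalised; as its weight is zero, any unit vector with the
      -- right entropy may stand in.
      · obtain ⟨φ, h1, -, h3⟩ := hscale z₀ hz₀
        refine ⟨φ, h1, ?_, h3⟩
        have h0 : Φ z = 0 := by
          ext x
          have := (Finset.sum_eq_zero_iff_of_nonneg fun x _ => sq_nonneg ‖Φ z x‖).1
            ((hnorm z).trans hz) x (Finset.mem_univ x)
          simpa using this
        rw [hz, h0]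
        simp
      · exact hscale z hz
    choose φ h1 h2 h3 using hall
    have := mem_ensembleValues_of_fintype S (ρ := ρ) (fun z => ∑ x, ‖χ z x‖ ^ 2) φ
      (fun z => Finset.sum_nonneg fun _ _ => sq_nonneg _) hχ h1
      (hρ.trans (Finset.sum_congr rfl fun z _ => (h2 z).symm))
    simpa only [h3, ← Finset.sum_mul, hχ, one_mul] using this
  have hlower : ∀ r ∈ ensembleValues S ρ, probEntropy S (fun p => ‖d p‖ ^ 2) ≤ r := by
    rintro r ⟨K, p, φ, hp, hp1, hφ, hρ', rfl⟩
    rw [← one_mul (probEntropy S _), ← hp1, Finset.sum_mul]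
    refine Finset.sum_le_sum fun k _ => ?_
    by_cases hk : p k = 0
    · simp [hk]
    refine mul_le_mul_of_nonneg_left ?_ (hp k)
    -- Lower bound: the vectors carrying the fixed Schmidt factor form a subspace that contains
    -- every `Φ z`, hence also `φ k`. The other factor `χ'` need not be a product any more.
    obtain ⟨χ', hχ'⟩ : ∃ χ' : a' × b' → ℂ,
        coeffMatrix (φ k) = F * (Matrix.diagonal d ⊗ₖ coeffMatrix χ') * G.transpose := by
      have hin := mem_span_of_ensemble hp (hρ.symm.trans hρ') hk
      generalize φ k = v at hin ⊢
      induction hin using Submodule.span_induction with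
      | mem v hv =>
        obtain ⟨z, rfl⟩ := hv
        exact ⟨χ z, hΦ z⟩
      | zero =>
        refine ⟨0, ?_⟩
        have h0 : ∀ {α β : Type}, coeffMatrix (0 : α × β → ℂ) = 0 := rfl
        simp [h0]
      | add v w _ _ hv hw =>
        obtain ⟨x, hx⟩ := hv
        obtain ⟨y, hy⟩ := hw
        have hadd : ∀ {α β : Type} (v w : α × β → ℂ),
          coeffMatrix (v + w) = coeffMatrix v + coeffMatrix w := fun _ _ => rfl
        exact ⟨x + y, by
          rw [hadd, hadd, hx, hy, Matrix.kronecker_add, Matrix.mul_add, Matrix.add_mul]⟩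
      | smul t v _ hv =>
        obtain ⟨x, hx⟩ := hv
        have hsmul : ∀ {α β : Type} (v : α × β → ℂ),
          coeffMatrix (t • v) = t • coeffMatrix v := fun _ => rfl
        exact ⟨t • x, by
          rw [hsmul, hsmul, hx, Matrix.kronecker_smul, Matrix.mul_smul, Matrix.smul_mul]⟩
    have hu : ∑ x, ‖χ' x‖ ^ 2 = 1 := (norm_sq_schmidt hF hG hd hχ').symm.trans (hφ k)
    rw [pureEntanglement_schmidt S hF hG hd hu hχ']
    exact le_add_of_nonneg_right (pureEntanglement_nonneg S χ' hu)
  exact le_antisymm (csInf_le ⟨_, hlower⟩ hmem) (le_csInf ⟨_, hmem⟩ hlower)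

/-! ### Products of generalized GHZ states shared between three sides -/

/-- The two amplitudes of a generalized GHZ state. -/
def ghzAmp (θ : ℝ) (s : Fin 2) : ℝ := if s = 0 then Real.cos θ else Real.sin θ

lemma sum_ghzAmp_sq (θ : ℝ) : ∑ s, ghzAmp θ s ^ 2 = 1 := by
  simp [Fin.sum_univ_two, ghzAmp]

lemma ghzVector_const {m : ℕ} (hm : 0 < m) (θ : ℝ) (s : Fin 2) :
    ghzVector θ m (fun _ => s) = ghzAmp θ s := by
  have : Nonempty (Fin m) := ⟨⟨0, hm⟩⟩
  fin_cases s <;> simp [ghzVector, ghzAmp]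

lemma exists_const_of_ghzVector_ne_zero {m : ℕ} {θ : ℝ} {x : Fin m → Fin 2}
    (h : ghzVector θ m x ≠ 0) : ∃ s, x = fun _ => s := by
  by_contra! hne
  refine h ?_
  have h0 : ¬ ∀ q, x q = 0 := fun h => hne 0 (funext h)
  have h1 : ¬ ∀ q, x q = 1 := fun h => hne 1 (funext h)
  simp [ghzVector, h0, h1]

lemma sum_norm_ghzVector {m : ℕ} (hm : 0 < m) (θ : ℝ) :
    ∑ x, ‖ghzVector θ m x‖ ^ 2 = 1 := by
  have : Nonempty (Fin m) := ⟨⟨0, hm⟩⟩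
  rw [← sum_ghzAmp_sq θ]
  refine (Fintype.sum_of_injective (fun s => (fun _ => s : Fin m → Fin 2))
    (fun s t h => congrFun h ⟨0, hm⟩) _ _ ?_ ?_).symm
  · intro x hx
    by_contra hne
    obtain ⟨s, rfl⟩ := exists_const_of_ghzVector_ne_zero
      (show ghzVector θ m x ≠ 0 from fun h => hne (by simp [h]))
    exact hx ⟨s, rfl⟩
  · intro s
    rw [ghzVector_const hm, Complex.norm_real, Real.norm_eq_abs, sq_abs]

/-- Rows and columns outside the support of `M` can be dropped. This cuts the qubit basis down to
states in which each crossing source has one common value per side. -/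
lemma mul_mul_transpose_eq_submatrix {a b α β γ δ : Type} [Fintype α] [Fintype β] [Fintype γ]
    [Fintype δ] (U : Matrix a α ℂ) (M : Matrix α β ℂ) (V : Matrix b β ℂ) {J : γ → α} {J' : δ → β}
    (hJ : Function.Injective J) (hJ' : Function.Injective J')
    (h : ∀ x y, M x y ≠ 0 → x ∈ Set.range J ∧ y ∈ Set.range J') :
    U * M * V.transpose = U.submatrix id J * M.submatrix J J' * (V.submatrix id J').transpose := by
  ext x y
  simp only [Matrix.mul_apply, Matrix.transpose_apply, Matrix.submatrix_apply, id]
  refine (Fintype.sum_of_injective J' hJ' _ _ ?_ ?_).symm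
  · intro v hv
    rw [Finset.sum_eq_zero, zero_mul]
    intro u _
    by_contra hne
    exact hv (h u v (right_ne_zero_of_mul hne)).2
  · intro v
    congr 1
    refine Fintype.sum_of_injective J hJ _ _ ?_ fun _ => rfl
    intro u hu
    by_contra hne
    exact hu (h u _ (right_ne_zero_of_mul hne)).1

lemma sum_prod_rotate {α β γ : Type} [Fintype α] [Fintype β] [Fintype γ] (F : α → β → γ → ℝ) :
    ∑ z, ∑ t : α × β, F t.1 t.2 z = ∑ t : α × β × γ, F t.1 t.2.1 t.2.2 := by
  simp only [Fintype.sum_prod_type]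
  rw [Finset.sum_comm]
  exact Finset.sum_congr rfl fun _ _ => Finset.sum_comm

namespace Tripartite

variable {K : Type} {m : K → ℕ} (side : (Σ k, Fin (m k)) → Fin 3)

/-- The computational basis of the qubits on side `i`. -/
abbrev SideLoc (i : Fin 3) : Type := {q // side q = i} → Fin 2

variable {side}

/-- The values of all qubits, given their values on the three sides. -/
def glue (x : SideLoc side 0) (y : SideLoc side 1) (z : SideLoc side 2) (q : Σ k, Fin (m k)) :
    Fin 2 :=
  if h0 : side q = 0 then x ⟨q, h0⟩ else if h1 : side q = 1 then y ⟨q, h1⟩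
  else z ⟨q, by omega⟩

lemma glue_zero (x : SideLoc side 0) (y : SideLoc side 1) (z : SideLoc side 2)
    {q : Σ k, Fin (m k)} (h : side q = 0) : glue x y z q = x ⟨q, h⟩ := by simp [glue, h]

lemma glue_one (x : SideLoc side 0) (y : SideLoc side 1) (z : SideLoc side 2)
    {q : Σ k, Fin (m k)} (h : side q = 1) : glue x y z q = y ⟨q, h⟩ := by simp [glue, h]

lemma glue_two (x : SideLoc side 0) (y : SideLoc side 1) (z : SideLoc side 2)
    {q : Σ k, Fin (m k)} (h : side q = 2) : glue x y z q = z ⟨q, h⟩ := by simp [glue, h]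

lemma glue_bijective : Function.Bijective
    fun t : SideLoc side 0 × SideLoc side 1 × SideLoc side 2 => glue t.1 t.2.1 t.2.2 := by
  constructor
  · rintro ⟨x, y, z⟩ ⟨x', y', z'⟩ h
    refine Prod.ext (funext fun q => ?_) (Prod.ext (funext fun q => ?_) (funext fun q => ?_))
    · simpa [glue_zero _ _ _ q.2] using congrFun h q.1
    · simpa [glue_one _ _ _ q.2] using congrFun h q.1
    · simpa [glue_two _ _ _ q.2] using congrFun h q.1
  · intro f
    refine ⟨(fun q => f q.1, fun q => f q.1, fun q => f q.1), funext fun q => ?_⟩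
    simp [glue]

variable (side)

/-- The source `k` is held by the sides `0` and `1` jointly, and only by them. -/
def Crossing (k : K) : Prop :=
  (∃ q, side ⟨k, q⟩ = 0) ∧ (∃ q, side ⟨k, q⟩ = 1) ∧ ∀ q, side ⟨k, q⟩ ≠ 2

/-- The computational basis of the qubits on side `i` of the sources which are not crossing. -/
abbrev RestLoc (i : Fin 3) : Type := {q : {q // side q = i} // ¬ Crossing side q.1.1} → Fin 2

open scoped Classical in
/-- The basis state of side `i` given by the common values `t.1 k` of the qubits of the crossing
sources `k` and the values `t.2` of the other qubits. -/
def expand (i : Fin 3) (t : ({k // Crossing side k} → Fin 2) × RestLoc side i) : SideLoc side i :=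
  fun q => if h : Crossing side q.1.1 then t.1 ⟨_, h⟩ else t.2 ⟨q, h⟩

variable {side}

lemma expand_of_crossing {i : Fin 3} (t) {q : {q // side q = i}} (h : Crossing side q.1.1) :
    expand side i t q = t.1 ⟨_, h⟩ := by simp [expand, h]

lemma expand_of_not_crossing {i : Fin 3} (t) {q : {q // side q = i}}
    (h : ¬ Crossing side q.1.1) : expand side i t q = t.2 ⟨q, h⟩ := by simp [expand, h]

/-- The common value of a crossing source can be read off any of its qubits on side `i`, which
exists by `hi`. -/
lemma expand_injective {i : Fin 3} (hi : ∀ k, Crossing side k → ∃ q, side ⟨k, q⟩ = i) :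
    Function.Injective (expand side i) := by
  intro t t' h
  refine Prod.ext (funext fun k => ?_) (funext fun q => ?_)
  · obtain ⟨q, hq⟩ := hi k.1 k.2
    have := congrFun h ⟨⟨k.1, q⟩, hq⟩
    rwa [expand_of_crossing _ k.2, expand_of_crossing _ k.2] at this
  · have := congrFun h q.1
    rwa [expand_of_not_crossing _ q.2, expand_of_not_crossing _ q.2] at this

lemma mem_range_expand {i : Fin 3} {x : SideLoc side i} (p : {k // Crossing side k} → Fin 2)
    (h : ∀ q : {q // side q = i}, ∀ hq : Crossing side q.1.1, x q = p ⟨_, hq⟩) :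
    x ∈ Set.range (expand side i) := by
  refine ⟨(p, fun q => x q.1), funext fun q => ?_⟩
  by_cases hq : Crossing side q.1.1
  · rw [expand_of_crossing _ hq, h q hq]
  · rw [expand_of_not_crossing _ hq]

variable (side) in
/-- The amplitude of source `k` in the product of generalized GHZ states with angles `θ`. -/
def sourceAmp (θ : K → ℝ) (x : SideLoc side 0) (y : SideLoc side 1) (z : SideLoc side 2) (k : K) :
    ℂ :=
  ghzVector (θ k) (m k) fun q => glue x y z ⟨k, q⟩

/-- All qubits of a crossing source lie on sides 0 and 1, and a GHZ amplitude vanishes unless the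
two common values agree. This is the Schmidt form: a diagonal coefficient matrix. -/
lemma sourceAmp_expand_of_crossing (θ : K → ℝ) {k : K} (hk : Crossing side k) (t u)
    (z : SideLoc side 2) :
    sourceAmp side θ (expand side 0 t) (expand side 1 u) z k =
      if t.1 ⟨k, hk⟩ = u.1 ⟨k, hk⟩ then (ghzAmp (θ k) (t.1 ⟨k, hk⟩) : ℂ) else 0 := by
  obtain ⟨q₀, hq₀⟩ := hk.1
  obtain ⟨q₁, hq₁⟩ := hk.2.1
  split_ifs with h
  · have : (fun q => glue (expand side 0 t) (expand side 1 u) z ⟨k, q⟩) =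
        fun _ => t.1 ⟨k, hk⟩ := by
      funext q
      by_cases h0 : side ⟨k, q⟩ = 0
      · rw [glue_zero _ _ _ h0, expand_of_crossing _ hk]
      · have h1 : side ⟨k, q⟩ = 1 := by
          have := hk.2.2 q
          omega
        rw [glue_one _ _ _ h1, expand_of_crossing _ hk, h]
    rw [sourceAmp, this, ghzVector_const (Fin.pos q₀)]
  · by_contra hne
    obtain ⟨s, hs⟩ := exists_const_of_ghzVector_ne_zero hne
    have e0 := congrFun hs q₀
    have e1 := congrFun hs q₁
    rw [glue_zero _ _ _ hq₀, expand_of_crossing _ hk] at e0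
    rw [glue_one _ _ _ hq₁, expand_of_crossing _ hk] at e1
    exact h (e0.trans e1.symm)

lemma sourceAmp_expand_of_not_crossing (θ : K → ℝ) {k : K} (hk : ¬ Crossing side k)
    (p p' r r' : {k // Crossing side k} → Fin 2) (a b) (z : SideLoc side 2) :
    sourceAmp side θ (expand side 0 (p, a)) (expand side 1 (p', b)) z k =
      sourceAmp side θ (expand side 0 (r, a)) (expand side 1 (r', b)) z k := by
  rw [sourceAmp, sourceAmp]
  congr 1
  funext q
  by_cases h0 : side ⟨k, q⟩ = 0
  · rw [glue_zero _ _ _ h0, glue_zero _ _ _ h0, expand_of_not_crossing _ hk,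
      expand_of_not_crossing _ hk]
  by_cases h1 : side ⟨k, q⟩ = 1
  · rw [glue_one _ _ _ h1, glue_one _ _ _ h1, expand_of_not_crossing _ hk,
      expand_of_not_crossing _ hk]
  · simp [glue, h0, h1]

lemma mem_range_expand_of_ne_zero (θ : K → ℝ) {x : SideLoc side 0} {y : SideLoc side 1}
    {z : SideLoc side 2} (h : ∀ k, sourceAmp side θ x y z k ≠ 0) :
    x ∈ Set.range (expand side 0) ∧ y ∈ Set.range (expand side 1) := by
  choose s hs using fun k => exists_const_of_ghzVector_ne_zero (h k)
  constructor
  · refine mem_range_expand (fun k => s k) fun q _ => ?_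
    rw [← congrFun (hs q.1.1) q.1.2, glue_zero _ _ _ q.2]
  · refine mem_range_expand (fun k => s k) fun q _ => ?_
    rw [← congrFun (hs q.1.1) q.1.2, glue_one _ _ _ q.2]

/-- A source which is not crossing is in a product state across the cut, for any fixed values of
the qubits on side `2`. -/
lemma sourceAmp_product (θ : K → ℝ) {k : K} (hk : ¬ Crossing side k) (z : SideLoc side 2) :
    ∃ (f : SideLoc side 0 → ℂ) (g : SideLoc side 1 → ℂ),
      ∀ x y, sourceAmp side θ x y z k = f x * g y := by
  classical
  have aux : ∀ i : Fin 3, i ≠ 2 → i ≠ 0 → i = 1 := by decide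
  by_cases h2 : ∃ q, side ⟨k, q⟩ = 2
  · obtain ⟨q₀, hq₀⟩ := h2
    -- One traced-out qubit with value `s` forces all other qubits of the source to be `s`, and this
    -- condition factors over the two sides.
    set s := z ⟨⟨k, q₀⟩, hq₀⟩ with hs
    refine ⟨fun x => if ∀ q, ∀ h : side ⟨k, q⟩ = 0, x ⟨_, h⟩ = s then 1 else 0,
      fun y => if (∀ q, ∀ h : side ⟨k, q⟩ = 1, y ⟨_, h⟩ = s) ∧
        ∀ q, ∀ h : side ⟨k, q⟩ = 2, z ⟨_, h⟩ = s then (ghzAmp (θ k) s : ℂ) else 0, ?_⟩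
    intro x y
    dsimp only
    by_cases hc : (fun q => glue x y z ⟨k, q⟩) = fun _ => s
    · rw [sourceAmp, hc, ghzVector_const (Fin.pos q₀), if_pos, if_pos, one_mul]
      · exact ⟨fun q h => by rw [← glue_one x y z h]; exact congrFun hc q,
          fun q h => by rw [← glue_two x y z h]; exact congrFun hc q⟩
      · exact fun q h => by rw [← glue_zero x y z h]; exact congrFun hc q
    · have hz : sourceAmp side θ x y z k = 0 := by
        by_contra hne
        obtain ⟨t, ht⟩ := exists_const_of_ghzVector_ne_zero hne
        have := congrFun ht q₀
        rw [glue_two x y z hq₀] at this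
        exact hc (by rw [ht, hs, this])
      rw [hz]
      split_ifs with h0 h1
      · refine (hc (funext fun q => ?_)).elim
        by_cases e0 : side ⟨k, q⟩ = 0
        · rw [glue_zero _ _ _ e0, h0 q e0]
        by_cases e1 : side ⟨k, q⟩ = 1
        · rw [glue_one _ _ _ e1, h1.1 q e1]
        have e2 : side ⟨k, q⟩ = 2 := by omega
        rw [glue_two _ _ _ e2, h1.2 q e2]
      all_goals simp
  -- With no qubit on side 2, a source that is not crossing lies entirely on one side.
  by_cases h0 : ∃ q, side ⟨k, q⟩ = 0
  · have h1 : ∀ q, side ⟨k, q⟩ = 0 := by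
      intro q
      by_contra hq
      exact hk ⟨h0, ⟨q, aux _ (fun h => h2 ⟨q, h⟩) hq⟩, fun q h => h2 ⟨q, h⟩⟩
    refine ⟨fun x => sourceAmp side θ x 0 z k, fun _ => 1, fun x y => ?_⟩
    simp only [sourceAmp, glue_zero _ _ _ (h1 _), mul_one]
  · have h1 : ∀ q, side ⟨k, q⟩ = 1 :=
      fun q => aux _ (fun h => h2 ⟨q, h⟩) fun h => h0 ⟨q, h⟩
    refine ⟨fun _ => 1, fun y => sourceAmp side θ 0 y z k, fun x y => ?_⟩
    simp only [sourceAmp, glue_one _ _ _ (h1 _), one_mul]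

lemma sum_norm_prod_sourceAmp [Fintype K] [DecidableEq K] (hm : ∀ k, 0 < m k) (θ : K → ℝ) :
    ∑ z, ∑ t : SideLoc side 0 × SideLoc side 1, ‖∏ k, sourceAmp side θ t.1 t.2 z k‖ ^ 2 = 1 := by
  have h1 : ∑ f : (Σ k, Fin (m k)) → Fin 2,
      ∏ k, ‖ghzVector (θ k) (m k) fun q => f ⟨k, q⟩‖ ^ 2 = 1 := by
    refine ((Equiv.piCurry fun (k : K) (_ : Fin (m k)) => Fin 2).sum_comp
      fun f => ∏ k, ‖ghzVector (θ k) (m k) (f k)‖ ^ 2).trans ?_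
    rw [← Fintype.prod_sum
      (fun k f => ‖ghzVector (θ k) (m k) f‖ ^ 2)]
    simp [sum_norm_ghzVector (hm _)]
  rw [sum_prod_rotate fun x y z => ‖∏ k, sourceAmp side θ x y z k‖ ^ 2, ← h1]
  refine Fintype.sum_bijective _ glue_bijective _ _ fun t => ?_
  rw [norm_prod, ← Finset.prod_pow]
  rfl

open scoped Kronecker Classical in
/-- The entanglement between the sides `0` and `1` of a product of generalized GHZ states, with
side `2` traced out and after local isometries. -/
theorem entanglement_eq (S : EntropyKind) [Fintype K] [DecidableEq K] (hm : ∀ k, 0 < m k) (θ : K → ℝ)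
    {a b c : Type} [Fintype a] [Fintype b] [Fintype c] [DecidableEq a]
    {U : Matrix a (SideLoc side 0) ℂ} {V : Matrix b (SideLoc side 1) ℂ}
    (hU : U.conjTranspose * U = 1) (hV : V.conjTranspose * V = 1) (e : c ≃ SideLoc side 2)
    {Φ : c → a × b → ℂ}
    (hΦ : ∀ z, coeffMatrix (Φ z) =
      U * Matrix.of (fun x y => ∏ k, sourceAmp side θ x y (e z) k) * V.transpose)
    {ρ : Matrix (a × b) (a × b) ℂ} (hρ : ρ = ∑ z, Matrix.vecMulVec (Φ z) (star (Φ z))) :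
    entanglement S ρ =
      ∑ k, if Crossing side k then probEntropy S (fun s => ghzAmp (θ k) s ^ 2) else 0 := by
  have hJ₀ : Function.Injective (expand side 0) := expand_injective fun _ h => h.1
  have hJ₁ : Function.Injective (expand side 1) := expand_injective fun _ h => h.2.1
  set M : SideLoc side 2 → Matrix (SideLoc side 0) (SideLoc side 1) ℂ :=
    fun z => Matrix.of fun x y => ∏ k, sourceAmp side θ x y z k with hM
  have hrange : ∀ z x y, M z x y ≠ 0 →
      x ∈ Set.range (expand side 0) ∧ y ∈ Set.range (expand side 1) := fun z x y h =>
    mem_range_expand_of_ne_zero θ fun k => Finset.prod_ne_zero_iff.1 h k (Finset.mem_univ k)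
  set d : ({k // Crossing side k} → Fin 2) → ℂ := 
    fun p => ∏ k : {k // Crossing side k}, (ghzAmp (θ k) (p k) : ℂ) with hd
  have hdn : ∀ p, ‖d p‖ ^ 2 = ∏ k : {k // Crossing side k}, ghzAmp (θ k) (p k) ^ 2 := fun p => by
    simp only [hd, norm_prod, Finset.prod_pow, Complex.norm_real, Real.norm_eq_abs]
    rw [← Finset.prod_pow, ← Finset.prod_pow]
    exact Finset.prod_congr rfl fun k _ => sq_abs _
  -- The amplitudes of the other sources do not depend on the values of the crossing ones, so `0` is
  -- an arbitrary reference value.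
  set χ : SideLoc side 2 → RestLoc side 0 × RestLoc side 1 → ℂ := fun z t => ∏ k : {k // ¬ Crossing side k},
    sourceAmp side θ (expand side 0 (0, t.1)) (expand side 1 (0, t.2)) z k with hχ
  have hsub : ∀ z, (M z).submatrix (expand side 0) (expand side 1) =
      Matrix.diagonal d ⊗ₖ coeffMatrix (χ z) := by
    intro z
    ext ⟨p, u⟩ ⟨p', v⟩
    simp only [hM, Matrix.submatrix_apply, Matrix.of_apply, Matrix.kroneckerMap_apply,
      coeffMatrix, hχ]
    rw [← Fintype.prod_subtype_mul_prod_subtype (Crossing side)]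
    congr 1
    · simp only [sourceAmp_expand_of_crossing θ (Subtype.prop _), Matrix.diagonal_apply, hd]
      split_ifs with h
      · simp [h]
      · obtain ⟨k, hk⟩ := Function.ne_iff.1 h
        exact Finset.prod_eq_zero (Finset.mem_univ k) (if_neg hk)
    · exact Finset.prod_congr rfl fun k _ => sourceAmp_expand_of_not_crossing θ k.2 _ _ _ _ _ _ _
  have hprod : ∀ z, ∃ (f : RestLoc side 0 → ℂ) (g : RestLoc side 1 → ℂ), ∀ t, χ z t = f t.1 * g t.2 := by
    intro z
    choose f g hfg using fun k : {k // ¬ Crossing side k} => sourceAmp_product θ k.2 z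
    refine ⟨fun u => ∏ k, f k (expand side 0 (0, u)), fun v => ∏ k, g k (expand side 1 (0, v)),
      fun t => ?_⟩
    simp only [hχ, hfg, Finset.prod_mul_distrib]
  have hform : ∀ {α β : Type} (U : Matrix α (SideLoc side 0) ℂ) (V : Matrix β (SideLoc side 1) ℂ) z,
      U * M z * V.transpose = U.submatrix id (expand side 0) *
        (Matrix.diagonal d ⊗ₖ coeffMatrix (χ z)) * (V.submatrix id (expand side 1)).transpose := by
    intro α β U V z
    rw [mul_mul_transpose_eq_submatrix _ _ _ hJ₀ hJ₁ (hrange z), hsub]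
  have hd1 : ∑ p, ‖d p‖ ^ 2 = 1 := by
    simp only [hdn]
    exact sum_pi_prod (d := fun (k : {k // Crossing side k}) s => ghzAmp (θ k) s ^ 2)
      fun k => sum_ghzAmp_sq _
  have hχ1 : ∑ z, ∑ t, ‖χ z t‖ ^ 2 = 1 := by
    rw [← sum_norm_prod_sourceAmp (side := side) hm θ]
    refine Finset.sum_congr rfl fun z _ => (norm_sq_schmidt
      (conjTranspose_mul_self_submatrix (U := 1) (by simp) hJ₀)
      (conjTranspose_mul_self_submatrix (U := 1) (by simp) hJ₁) hd1 ?_).symm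
    rw [← hform]
    simp [hM, coeffMatrix]
  rw [entanglement_eq_of_schmidt S (conjTranspose_mul_self_submatrix hU hJ₀)
    (conjTranspose_mul_self_submatrix hV hJ₁) hd1 (fun z => (hΦ z).trans (hform U V (e z)))
    (fun z => hprod (e z)) ((e.sum_comp fun z => ∑ t, ‖χ z t‖ ^ 2).trans hχ1) hρ]
  simp only [hdn]
  rw [probEntropy_pi S (d := fun (k : {k // Crossing side k}) s => ghzAmp (θ k) s ^ 2)
    (fun _ _ => sq_nonneg _) (fun k => sum_ghzAmp_sq _), ← Finset.sum_filter]
  exact (Finset.sum_subtype _ (by simp) fun k => probEntropy S fun s => ghzAmp (θ k) s ^ 2).symm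

end Tripartite

/-! ### Networks -/

lemma pi_unitary_isometry {T : Type} [Fintype T] [DecidableEq T] {H : T → Type}
    [∀ t, Fintype (H t)] [∀ t, DecidableEq (H t)] (U : ∀ t, Matrix.unitaryGroup (H t) ℂ) :
    (Matrix.of fun f g : ∀ t, H t => ∏ t, (U t : Matrix (H t) (H t) ℂ) (f t) (g t)).conjTranspose *
      (Matrix.of fun f g : ∀ t, H t => ∏ t, (U t : Matrix (H t) (H t) ℂ) (f t) (g t)) = 1 := by
  ext f g
  have h : ∀ t, ∑ x, star ((U t : Matrix (H t) (H t) ℂ) x (f t)) *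
      (U t : Matrix (H t) (H t) ℂ) x (g t) = if f t = g t then 1 else 0 := fun t => by
    have := congrFun (congrFun (Matrix.UnitaryGroup.star_mul_self (U t)) (f t)) (g t)
    simpa [Matrix.mul_apply, Matrix.one_apply] using this
  simp only [Matrix.mul_apply, Matrix.conjTranspose_apply, Matrix.of_apply, star_prod,
    ← Finset.prod_mul_distrib, Matrix.one_apply]
  rw [← Fintype.prod_sum fun t x => star ((U t : Matrix (H t) (H t) ℂ) x (f t)) *
      (U t : Matrix (H t) (H t) ℂ) x (g t)]
  simp only [h]
  split_ifs with hfg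
  · simp [hfg]
  · obtain ⟨t, ht⟩ := Function.ne_iff.1 hfg
    exact Finset.prod_eq_zero (Finset.mem_univ t) (if_neg ht)

/-- A unitary on the traced-out system does not change the reduced state. -/
lemma sum_mulVec_mul_star {Z : Type} [Fintype Z] [DecidableEq Z] {W : Matrix Z Z ℂ}
    (hW : W.conjTranspose * W = 1) (v w : Z → ℂ) :
    ∑ z, (∑ z₀, W z z₀ * v z₀) * star (∑ z₀, W z z₀ * w z₀) = ∑ z, v z * star (w z) := by
  have h : (W.mulVec v) ⬝ᵥ star (W.mulVec w) = v ⬝ᵥ star w := by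
    rw [Matrix.star_mulVec, dotProduct_comm, ← Matrix.dotProduct_mulVec, Matrix.mulVec_mulVec, hW,
      Matrix.one_mulVec, dotProduct_comm]
  exact h

section

variable {I : Type} [DecidableEq I] {H : I → Type} (i : I)

lemma piSplitAt_symm_same (x : H i) (y : ∀ j : {j // j ≠ i}, H j) :
    (Equiv.piSplitAt i H).symm (x, y) i = x :=
  congrArg Prod.fst ((Equiv.piSplitAt i H).apply_symm_apply (x, y))

lemma piSplitAt_symm_ne (x : H i) (y : ∀ j : {j // j ≠ i}, H j) (j : {j // j ≠ i}) :
    (Equiv.piSplitAt i H).symm (x, y) j = y j :=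
  congrFun (congrArg Prod.snd ((Equiv.piSplitAt i H).apply_symm_apply (x, y))) j

end

lemma mul_submatrix_mul_transpose {a b α β : Type} [Fintype a] [Fintype b] [Fintype α] [Fintype β]
    (U : Matrix a a ℂ) (M : Matrix α β ℂ) (V : Matrix b b ℂ) (e : a ≃ α) (e' : b ≃ β) :
    U * M.submatrix e e' * V.transpose =
      U.submatrix id e.symm * M * (V.submatrix id e'.symm).transpose := by
  rw [mul_mul_transpose_eq_submatrix (U.submatrix id e.symm) M (V.submatrix id e'.symm)
    e.injective e'.injective fun x y _ => ⟨e.surjective x, e'.surjective y⟩]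
  simp [Matrix.submatrix_submatrix]

namespace QNetwork

variable {n : ℕ} (N : QNetwork n)

variable {N} in
lemma bit_some (f : ∀ i, N.Party i) (e : N.Loc none) {q : N.Qubit} {i : Fin n}
    (h : N.holder q.1 q.2 = some i) : N.bit f e q = f i ⟨q, h⟩ := by
  unfold bit
  split
  · next h' => exact absurd (h'.symm.trans h) (by simp)
  · rename_i j hj
    obtain rfl : i = j := Option.some_injective _ (h.symm.trans hj)
    rfl

variable {N} in
lemma bit_none (f : ∀ i, N.Party i) (e : N.Loc none) {q : N.Qubit}
    (h : N.holder q.1 q.2 = none) : N.bit f e q = e ⟨q, h⟩ := by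
  unfold bit
  split
  · rfl
  · next h' => exact absurd (h'.symm.trans h) (by simp)

lemma bit_bijective :
    Function.Bijective fun t : (∀ i, N.Party i) × N.Loc none => N.bit t.1 t.2 := by
  constructor
  · rintro ⟨f, e⟩ ⟨f', e'⟩ h
    refine Prod.ext (funext fun i => funext fun q => ?_) (funext fun q => ?_)
    · simpa [bit_some _ _ q.2] using congrFun h q.1
    · simpa [bit_none _ _ q.2] using congrFun h q.1
  · intro g
    refine ⟨(fun i q => g q.1, fun q => g q.1), funext fun q => ?_⟩
    rcases hq : N.holder q.1 q.2 with _ | i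
    · simp [bit_none _ _ hq]
    · simp [bit_some _ _ hq]

/-- The joint pure state of the parties and of the qubits outside the network after the local
unitaries. -/
def purification (U : ∀ i, Matrix.unitaryGroup (N.Party i) ℂ) (f : ∀ i, N.Party i)
    (e : N.Loc none) : ℂ :=
  ∑ f₀, N.localUnitary U f f₀ * N.sourceVector f₀ e

lemma state_apply (U : ∀ i, Matrix.unitaryGroup (N.Party i) ℂ) (f g : ∀ i, N.Party i) :
    N.state U f g = ∑ e, N.purification U f e * star (N.purification U g e) := by
  simp only [state, Matrix.mul_apply, sourceState, Matrix.of_apply, Matrix.conjTranspose_apply,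
    purification, star_sum, star_mul', Finset.mul_sum, Finset.sum_mul]
  rw [Finset.sum_comm]
  simp_rw [Finset.sum_comm (s := (Finset.univ : Finset (∀ i, N.Party i)))
    (t := (Finset.univ : Finset (N.Loc none)))]
  refine Finset.sum_congr rfl fun _ _ => Finset.sum_comm.trans ?_
  exact Finset.sum_congr rfl fun _ _ => Finset.sum_congr rfl fun _ _ => by ring

open Tripartite in
open scoped Classical in
/-- The entanglement between two groups of parties of a network, when all other parties are traced
out. -/
theorem entanglement_of_split (S : EntropyKind) (Uf : ∀ i, Matrix.unitaryGroup (N.Party i) ℂ)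
    {a b Z : Type} [Fintype a] [Fintype b] [Fintype Z] [DecidableEq a] [DecidableEq b]
    [DecidableEq Z] (E : (∀ i, N.Party i) ≃ a × b × Z)
    {U : Matrix a a ℂ} {V : Matrix b b ℂ} {W : Matrix Z Z ℂ} (hU : U.conjTranspose * U = 1)
    (hV : V.conjTranspose * V = 1) (hW : W.conjTranspose * W = 1)
    (hsplit : ∀ x y z x₀ y₀ z₀, N.localUnitary Uf (E.symm (x, y, z)) (E.symm (x₀, y₀, z₀)) =
      U x x₀ * V y y₀ * W z z₀)
    (side : N.Qubit → Fin 3)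
    (h0 : ∀ q, side q = 0 → ∀ x y z e y' z' e',
      N.bit (E.symm (x, y, z)) e q = N.bit (E.symm (x, y', z')) e' q)
    (h1 : ∀ q, side q = 1 → ∀ x y z e x' z' e',
      N.bit (E.symm (x, y, z)) e q = N.bit (E.symm (x', y, z')) e' q)
    (h2 : ∀ q, side q = 2 → ∀ x y z e x' y',
      N.bit (E.symm (x, y, z)) e q = N.bit (E.symm (x', y', z)) e q)
    {ρ : Matrix (a × b) (a × b) ℂ}
    (hρ : ∀ x y x' y', ρ (x, y) (x', y') =
      ∑ z, N.state Uf (E.symm (x, y, z)) (E.symm (x', y', z))) :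
    entanglement S ρ = ∑ k, if Crossing side k then
      probEntropy S (fun s => ghzAmp (N.angle k) s ^ 2) else 0 := by
  -- An arbitrary base point: by `h0`, `h1`, `h2` the bits of each side can be read with the other
  -- coordinates frozen there.
  obtain ⟨xd, yd, zd⟩ := E fun _ _ => 0
  let ed : N.Loc none := fun _ => 0
  let rA : a → SideLoc side 0 := fun x q => N.bit (E.symm (x, yd, zd)) ed q
  let rB : b → SideLoc side 1 := fun y q => N.bit (E.symm (xd, y, zd)) ed q
  let rC : Z × N.Loc none → SideLoc side 2 := fun z q => N.bit (E.symm (xd, yd, z.1)) z.2 q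
  have hbit : ∀ x y z, N.bit (E.symm (x, y, z.1)) z.2 = glue (rA x) (rB y) (rC z) := by
    intro x y z
    funext q
    by_cases e0 : side q = 0
    · rw [glue_zero _ _ _ e0]
      exact h0 q e0 _ _ _ _ _ _ _
    by_cases e1 : side q = 1
    · rw [glue_one _ _ _ e1]
      exact h1 q e1 _ _ _ _ _ _ _
    have e2 : side q = 2 := by omega
    rw [glue_two _ _ _ e2]
    exact h2 q e2 _ _ _ _ _ _
  -- Gluing the three readings recovers all bits bijectively, and gluing is itself bijective. So the
  -- product of the readings is bijective, and with nonempty factors so is each one.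
  have hbij : Function.Bijective (Prod.map rA (Prod.map rB rC)) := by
    have hE : Function.Bijective fun t : a × b × Z × N.Loc none =>
        (E.symm (t.1, t.2.1, t.2.2.1), t.2.2.2) := by
      constructor
      · rintro ⟨x, y, z, e⟩ ⟨x', y', z', e'⟩ h
        simpa [and_assoc] using h
      · rintro ⟨f, e⟩
        exact ⟨((E f).1, (E f).2.1, (E f).2.2, e), by simp⟩
    have hc := N.bit_bijective.comp hE
    refine (Function.Bijective.of_comp_iff' (glue_bijective (side := side)) _).1 ?_
    convert hc using 1
    funext t
    exact (hbit t.1 t.2.1 t.2.2).symm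
  have : Nonempty a := ⟨xd⟩
  have : Nonempty b := ⟨yd⟩
  have : Nonempty Z := ⟨zd⟩
  obtain ⟨bA, hBC⟩ := Prod.map_bijective.1 hbij
  obtain ⟨bB, bC⟩ := Prod.map_bijective.1 hBC
  let eA := Equiv.ofBijective rA bA
  let eB := Equiv.ofBijective rB bB
  let eC := Equiv.ofBijective rC bC
  set M : Z × N.Loc none → Matrix a b ℂ :=
    fun z => Matrix.of fun x y => N.sourceVector (E.symm (x, y, z.1)) z.2 with hM
  have hMsub : ∀ z, M z = (Matrix.of fun x y => ∏ k, sourceAmp side N.angle x y (eC z) k).submatrix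
      eA eB := by
    intro z
    ext x y
    simp only [hM, Matrix.of_apply, Matrix.submatrix_apply, sourceVector, sourceAmp, hbit]
    rfl
  refine Tripartite.entanglement_eq S (fun k => by have := N.two_le_arity k; omega) N.angle
    (conjTranspose_mul_self_submatrix hU eA.symm.injective)
    (conjTranspose_mul_self_submatrix hV eB.symm.injective) eC (Φ := fun z t => (U * M z * V.transpose) t.1 t.2) ?_ ?_
  · intro z
    have : coeffMatrix (fun t : a × b => (U * M z * V.transpose) t.1 t.2) =
        U * M z * V.transpose := rfl
    rw [this, hMsub, mul_submatrix_mul_transpose]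
  -- After the local unitaries, `W` only mixes the vectors `Φ` over the traced-out index `z`, so it
  -- disappears from the reduced state.
  · have hpur : ∀ x y z e, N.purification Uf (E.symm (x, y, z)) e =
        ∑ z₀, W z z₀ * (U * M (z₀, e) * V.transpose) x y := by
      intro x y z e
      rw [purification, ← E.symm.sum_comp]
      simp only [Fintype.sum_prod_type, hsplit, Matrix.mul_apply, Matrix.transpose_apply, hM,
        Matrix.of_apply, Finset.sum_mul, Finset.mul_sum]
      simp_rw [Finset.sum_comm (s := (Finset.univ : Finset b)) (t := (Finset.univ : Finset Z))]
      rw [Finset.sum_comm]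
      refine Finset.sum_congr rfl fun _ _ => ?_
      rw [Finset.sum_comm]
      exact Finset.sum_congr rfl fun _ _ => Finset.sum_congr rfl fun _ _ => by ring
    ext ⟨x, y⟩ ⟨x', y'⟩
    simp only [hρ, state_apply, hpur, Matrix.sum_apply, Matrix.vecMulVec_apply, Pi.star_apply,
      Fintype.sum_prod_type]
    rw [Finset.sum_comm, Finset.sum_comm (s := (Finset.univ : Finset Z))]
    exact Finset.sum_congr rfl fun e _ => sum_mulVec_mul_star hW _ _

/-- The sides of the cut "party `i` versus all other parties". -/
def cutSide (i : Fin n) (q : N.Qubit) : Fin 3 :=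
  if N.holder q.1 q.2 = some i then 0 else if N.holder q.1 q.2 = none then 2 else 1

/-- The sides of the cut "party `i` versus party `j`". -/
def pairSide (i j : Fin n) (q : N.Qubit) : Fin 3 :=
  if N.holder q.1 q.2 = some i then 0 else if N.holder q.1 q.2 = some j then 1 else 2

-- No party is traced out here, so the third system is `Unit`; side 2 consists only of the qubits
-- outside the network.
open scoped Classical in
theorem entanglement_cutState (S : EntropyKind) (U : ∀ i, Matrix.unitaryGroup (N.Party i) ℂ)
    (i : Fin n) :
    entanglement S (cutState (N.state U) i) =
      ∑ k, if Tripartite.Crossing (N.cutSide i) k then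
        probEntropy S (fun s => ghzAmp (N.angle k) s ^ 2) else 0 := by
  refine N.entanglement_of_split S U (Z := Unit)
    ((Equiv.piSplitAt i N.Party).trans ((Equiv.refl _).prodCongr (Equiv.prodPUnit _).symm))
    (U := U i) (V := Matrix.of fun f g => ∏ j : {j // j ≠ i}, (U j).1 (f j) (g j)) (W := 1)
    (Matrix.UnitaryGroup.star_mul_self (U i)) (pi_unitary_isometry fun j : {j // j ≠ i} => U j)
    (by simp) ?_ _ ?_ ?_ ?_ ?_
  · intro x y z x₀ y₀ z₀
    have : ∀ (x) (y) (z : Unit), ((Equiv.piSplitAt i N.Party).trans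
        ((Equiv.refl _).prodCongr (Equiv.prodPUnit _).symm)).symm (x, y, z) =
        (Equiv.piSplitAt i N.Party).symm (x, y) := fun _ _ _ => rfl
    rw [this, this, localUnitary, Matrix.of_apply, Fintype.prod_eq_mul_prod_subtype_ne _ i]
    simp only [piSplitAt_symm_same, piSplitAt_symm_ne]
    simp
  · intro q hq x y z e y' z' e'
    have h : N.holder q.1 q.2 = some i := by
      by_contra h
      unfold cutSide at hq
      split_ifs at hq <;> simp_all
    rw [bit_some _ _ h, bit_some _ _ h]
    exact congrFun ((piSplitAt_symm_same i x y).trans (piSplitAt_symm_same i x y').symm) _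
  · intro q hq x y z e x' z' e'
    obtain ⟨j, h, hj⟩ : ∃ j, N.holder q.1 q.2 = some j ∧ j ≠ i := by
      rcases h : N.holder q.1 q.2 with _ | j
      · simp [cutSide, h] at hq
      · exact ⟨j, rfl, fun hj => by simp [cutSide, h, hj] at hq⟩
    rw [bit_some _ _ h, bit_some _ _ h]
    exact congrFun ((piSplitAt_symm_ne i x y ⟨j, hj⟩).trans
      (piSplitAt_symm_ne i x' y ⟨j, hj⟩).symm) _
  · intro q hq x y z e x' y'
    have h : N.holder q.1 q.2 = none := by
      by_contra h
      unfold cutSide at hq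
      split_ifs at hq <;> simp_all
    rw [bit_none _ _ h, bit_none _ _ h]
  · intro x y x' y'
    rw [Fintype.sum_unique]
    rfl

-- Side 2 now contains the qubits of all parties other than `i` and `j`, besides those outside the
-- network.
open scoped Classical in
theorem entanglement_pairState (S : EntropyKind) (U : ∀ i, Matrix.unitaryGroup (N.Party i) ℂ)
    (i : Fin n) (j : {j // j ≠ i}) :
    entanglement S (pairState (N.state U) i j) =
      ∑ k, if Tripartite.Crossing (N.pairSide i j) k then
        probEntropy S (fun s => ghzAmp (N.angle k) s ^ 2) else 0 := by
  set E := (Equiv.piSplitAt i N.Party).trans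
    ((Equiv.refl _).prodCongr (Equiv.piSplitAt j fun k : {k // k ≠ i} => N.Party k)) with hE
  have hsymm : ∀ x y z, E.symm (x, y, z) = (Equiv.piSplitAt i N.Party).symm
      (x, (Equiv.piSplitAt j fun k : {k // k ≠ i} => N.Party k).symm (y, z)) := fun _ _ _ => rfl
  have hi : ∀ x y z, E.symm (x, y, z) i = x := fun x y z => piSplitAt_symm_same i _ _
  have hj : ∀ x y z, E.symm (x, y, z) j = y := fun x y z =>
    (piSplitAt_symm_ne i _ _ j).trans (piSplitAt_symm_same j _ _)
  have hk : ∀ x y z (k : {k : {k // k ≠ i} // k ≠ j}), E.symm (x, y, z) k = z k :=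
    fun x y z k => (piSplitAt_symm_ne i _ _ k.1).trans (piSplitAt_symm_ne j _ _ k)
  refine N.entanglement_of_split S U E (U := U i) (V := U j)
    (W := Matrix.of fun f g => ∏ k : {k : {k // k ≠ i} // k ≠ j}, (U k).1 (f k) (g k))
    (Matrix.UnitaryGroup.star_mul_self (U i)) (Matrix.UnitaryGroup.star_mul_self (U j))
    (pi_unitary_isometry fun k : {k : {k // k ≠ i} // k ≠ j} => U k) ?_ (N.pairSide i j) ?_ ?_ ?_ ?_
  · intro x y z x₀ y₀ z₀
    rw [localUnitary, Matrix.of_apply, Fintype.prod_eq_mul_prod_subtype_ne _ i,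
      Fintype.prod_eq_mul_prod_subtype_ne _ j]
    simp only [hi, hj, hk, Matrix.of_apply, mul_assoc]
  · intro q hq x y z e y' z' e'
    have h : N.holder q.1 q.2 = some i := by
      by_contra h
      unfold pairSide at hq
      split_ifs at hq <;> simp_all
    rw [bit_some _ _ h, bit_some _ _ h, hi, hi]
  · intro q hq x y z e x' z' e'
    have h : N.holder q.1 q.2 = some j.1 := by
      by_contra h
      unfold pairSide at hq
      split_ifs at hq <;> simp_all
    rw [bit_some _ _ h, bit_some _ _ h, hj, hj]
  · intro q hq x y z e x' y'
    rcases h : N.holder q.1 q.2 with _ | k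
    · rw [bit_none _ _ h, bit_none _ _ h]
    · have hki : k ≠ i := fun hki => by simp [pairSide, h, hki] at hq
      have hkj : k ≠ j := fun hkj => by simp [pairSide, h, hkj, j.2] at hq
      rw [bit_some _ _ h, bit_some _ _ h]
      have := hk x y z ⟨⟨k, hki⟩, fun h => hkj (congrArg Subtype.val h)⟩
      have := hk x' y' z ⟨⟨k, hki⟩, fun h => hkj (congrArg Subtype.val h)⟩
      simp_all
  · intro x y x' y'
    rfl

/-! ### Which sources cross a cut -/

variable {N}

lemma mem_parties {k : Fin N.numSources} {i : Fin n} :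
    i ∈ N.parties k ↔ ∃ q, N.holder k q = some i := by
  simp [parties]

/-- Each party of a source needs a qubit of its own. Hence a source held by three parties is a GHZ
state, not an EPR state. -/
lemma card_parties_le_arity (k : Fin N.numSources) : (N.parties k).card ≤ N.arity k := by
  have h : (N.parties k).image some ⊆ Finset.univ.image (N.holder k) := by
    intro o ho
    obtain ⟨i, hi, rfl⟩ := Finset.mem_image.1 ho
    obtain ⟨q, hq⟩ := mem_parties.1 hi
    exact Finset.mem_image.2 ⟨q, Finset.mem_univ q, hq⟩
  calc (N.parties k).card = ((N.parties k).image some).card :=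
        (Finset.card_image_of_injective _ (Option.some_injective _)).symm
    _ ≤ _ := Finset.card_le_card h
    _ ≤ _ := Finset.card_image_le
    _ = N.arity k := by simp

lemma crossing_cutSide {i : Fin n} {k : Fin N.numSources} :
    Tripartite.Crossing (N.cutSide i) k ↔
      N.IsInside k ∧ i ∈ N.parties k ∧ 2 ≤ (N.parties k).card := by
  have h0 : ∀ q, N.cutSide i ⟨k, q⟩ = 0 ↔ N.holder k q = some i := fun q => by
    unfold cutSide; split_ifs <;> simp_all
  have h1 : ∀ q, N.cutSide i ⟨k, q⟩ = 1 ↔ ∃ j, j ≠ i ∧ N.holder k q = some j := fun q => by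
    rcases h : N.holder k q with _ | j
    · simp [cutSide, h]
    · by_cases hj : j = i <;> simp [cutSide, h, hj]
  have h2 : ∀ q, N.cutSide i ⟨k, q⟩ = 2 ↔ N.holder k q = none := fun q => by
    unfold cutSide; split_ifs <;> simp_all
  simp only [Tripartite.Crossing, h0, h1, ne_eq, h2, ← mem_parties]
  constructor
  · rintro ⟨hi, ⟨q, j, hj, hq⟩, hin⟩
    exact ⟨hin, hi, Finset.one_lt_card.2 ⟨j, mem_parties.2 ⟨q, hq⟩, i, hi, hj⟩⟩
  · rintro ⟨hin, hi, hc⟩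
    obtain ⟨j, hj, hji⟩ := Finset.exists_mem_ne hc i
    obtain ⟨q, hq⟩ := mem_parties.1 hj
    exact ⟨hi, ⟨q, j, hji, hq⟩, hin⟩

lemma crossing_pairSide {i j : Fin n} (hji : j ≠ i) {k : Fin N.numSources} :
    Tripartite.Crossing (N.pairSide i j) k ↔ N.IsInside k ∧ N.parties k = {i, j} := by
  have h0 : ∀ q, N.pairSide i j ⟨k, q⟩ = 0 ↔ N.holder k q = some i := fun q => by
    unfold pairSide; split_ifs <;> simp_all
  have h1 : ∀ q, N.pairSide i j ⟨k, q⟩ = 1 ↔ N.holder k q = some j := fun q => by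
    unfold pairSide
    split_ifs with h <;> simp_all [hji.symm]
  have h2 : ∀ q, N.pairSide i j ⟨k, q⟩ ≠ 2 ↔ N.holder k q = some i ∨ N.holder k q = some j :=
    fun q => by unfold pairSide; split_ifs <;> simp_all
  simp only [Tripartite.Crossing, h0, h1, h2, ← mem_parties]
  constructor
  · rintro ⟨hi, hj, hq⟩
    refine ⟨fun q h => by simpa [h] using hq q, Finset.Subset.antisymm (fun l hl => ?_) ?_⟩
    · obtain ⟨q, hl⟩ := mem_parties.1 hl
      simpa [hl] using hq q
    · simp [Finset.insert_subset_iff, hi, hj]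
  · rintro ⟨hin, h⟩
    refine ⟨by simp [h], by simp [h], fun q => ?_⟩
    rcases hq : N.holder k q with _ | l
    · exact (hin q hq).elim
    · have : l ∈ N.parties k := mem_parties.2 ⟨q, hq⟩
      simpa [h] using this

open scoped Classical in
/-- A source contributes to the entanglement of party `i` with all other parties either through one
of the two-party marginals or if it is held by at least three parties. -/
lemma crossing_cutSide_eq_sum (i : Fin n) (k : Fin N.numSources) (r : ℝ) :
    (if Tripartite.Crossing (N.cutSide i) k then r else 0) =
      (∑ j : {j // j ≠ i}, if Tripartite.Crossing (N.pairSide i j) k then r else 0) +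
        if N.IsInside k ∧ i ∈ N.parties k ∧ 3 ≤ (N.parties k).card then r else 0 := by
  have hcard : ∀ j : {j // j ≠ i}, N.parties k = {i, j.1} → (N.parties k).card = 2 :=
    fun j h => by rw [h, Finset.card_pair j.2.symm]
  have hpair : ∀ j : {j // j ≠ i}, Tripartite.Crossing (N.pairSide i j) k ↔
      N.IsInside k ∧ N.parties k = {i, j.1} := fun j => crossing_pairSide j.2
  simp only [crossing_cutSide, hpair]
  by_cases hin : N.IsInside k
  swap
  · simp [hin]
  by_cases hi : i ∈ N.parties k
  swap
  · have : ∀ j, N.parties k ≠ {i, j} := fun j h => hi (by simp [h])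
    simp [hi, this]
  simp only [hin, hi, true_and]
  -- A lone holder contributes to neither cut, two holders to the full cut and exactly one pair,
  -- three or more to the full cut only.
  rcases lt_trichotomy (N.parties k).card 2 with hc | hc | hc
  · rw [if_neg (by omega), if_neg (by omega), add_zero]
    refine (Finset.sum_eq_zero fun j _ => if_neg fun h => ?_).symm
    have := hcard j h
    omega
  · rw [if_pos hc.ge, if_neg (by omega), add_zero]
    obtain ⟨j, hj, hji⟩ := Finset.exists_mem_ne hc.ge i
    have hp : N.parties k = {i, j} := by
      refine (Finset.eq_of_subset_of_card_le ?_ ?_).symm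
      · simp [Finset.insert_subset_iff, hi, hj]
      · rw [hc, Finset.card_pair hji.symm]
    rw [Fintype.sum_eq_single ⟨j, hji⟩, if_pos hp]
    intro l hl
    refine if_neg fun h => hl (Subtype.ext ?_)
    have : l.1 ∈ ({i, j} : Finset (Fin n)) := by rw [← hp, h]; simp
    simpa [l.2] using this
  · rw [if_pos (by omega), if_pos (by omega), Finset.sum_eq_zero, zero_add]
    refine fun j _ => if_neg fun h => ?_
    have := hcard j h
    omega

end QNetwork

/-! ### Degenerate angles and the main theorem -/

lemma probEntropy_ghzAmp_nonneg (S : EntropyKind) (θ : ℝ) :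
    0 ≤ probEntropy S fun s => ghzAmp θ s ^ 2 :=
  probEntropy_nonneg S (fun _ => sq_nonneg _) (sum_ghzAmp_sq θ)

lemma probEntropy_ghzAmp_eq_zero_iff (S : EntropyKind) (θ : ℝ) :
    (probEntropy S fun s => ghzAmp θ s ^ 2) = 0 ↔ ¬ (Real.cos θ ≠ 0 ∧ Real.sin θ ≠ 0) := by
  have hcs := Real.sin_sq_add_cos_sq θ
  constructor
  · rintro h ⟨hc, hs⟩
    have h1 := sq_pos_of_ne_zero hc
    have h2 := sq_pos_of_ne_zero hs
    exact (probEntropy_pos S (fun s => sq_nonneg (ghzAmp θ s)) (sum_ghzAmp_sq θ) (x := 0)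
      (by simpa [ghzAmp] using h1) (by simp only [ghzAmp, if_true]; linarith)).ne' h
  · intro h
    refine probEntropy_eq_zero S (sum_ghzAmp_sq θ) fun s => ?_
    rw [not_and_or, not_not, not_not] at h
    rcases h with h | h <;> rw [h] at hcs <;> fin_cases s <;> simp [ghzAmp, h] <;>
      exact Or.inr (by simpa using hcs)

end

theorem theorem1 {n : ℕ} (N : QNetwork n) (U : ∀ i, Matrix.unitaryGroup (N.Party i) ℂ)
    (S : EntropyKind) :
    (∀ i : Fin n,
      ∑ j : {j // j ≠ i}, entanglement S (pairState (N.state U) i j) ≤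
        entanglement S (cutState (N.state U) i)) ∧
    (∀ i : Fin n,
      entanglement S (cutState (N.state U) i) =
          ∑ j : {j // j ≠ i}, entanglement S (pairState (N.state U) i j) ↔
        ∀ k, N.IsGHZ k → N.IsNondegenerate k → N.IsInside k → i ∈ N.parties k →
          (N.parties k).card ≤ 2) ∧
    ((∀ k, N.IsGHZ k → N.IsNondegenerate k ∧ N.IsInside k) →
      ((∀ i : Fin n,
        entanglement S (cutState (N.state U) i) =
          ∑ j : {j // j ≠ i}, entanglement S (pairState (N.state U) i j)) ↔
        ∀ k, N.IsGHZ k → (N.parties k).card ≤ 2)) := by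
  classical
  have hsum : ∀ i : Fin n, entanglement S (cutState (N.state U) i) =
      (∑ j : {j // j ≠ i}, entanglement S (pairState (N.state U) i j)) +
        ∑ k, if N.IsInside k ∧ i ∈ N.parties k ∧ 3 ≤ (N.parties k).card then
          probEntropy S (fun s => ghzAmp (N.angle k) s ^ 2) else 0 := by
    intro i
    simp only [N.entanglement_cutState, N.entanglement_pairState]
    rw [Finset.sum_comm, ← Finset.sum_add_distrib]
    exact Finset.sum_congr rfl fun k _ => QNetwork.crossing_cutSide_eq_sum i k _
  have hnonneg : ∀ i : Fin n, ∀ k, 0 ≤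
      if N.IsInside k ∧ i ∈ N.parties k ∧ 3 ≤ (N.parties k).card then
        probEntropy S (fun s => ghzAmp (N.angle k) s ^ 2) else 0 := by
    intro i k
    split_ifs
    · exact probEntropy_ghzAmp_nonneg S _
    · exact le_rfl
  have hiff : ∀ i : Fin n, entanglement S (cutState (N.state U) i) =
          ∑ j : {j // j ≠ i}, entanglement S (pairState (N.state U) i j) ↔
        ∀ k, N.IsGHZ k → N.IsNondegenerate k → N.IsInside k → i ∈ N.parties k →
          (N.parties k).card ≤ 2 := by
    intro i
    rw [hsum i, add_eq_left, Fintype.sum_eq_zero_iff_of_nonneg (hnonneg i), funext_iff]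
    refine forall_congr' fun k => ?_
    simp only [Pi.zero_apply, ite_eq_right_iff, probEntropy_ghzAmp_eq_zero_iff]
    constructor
    · intro h _ hnd hin hi
      by_contra hc
      exact h ⟨hin, hi, by omega⟩ hnd
    · rintro h ⟨hin, hi, hc⟩ hnd
      have := h (hc.trans (QNetwork.card_parties_le_arity k)) hnd hin hi
      omega
  refine ⟨fun i => ?_, hiff, fun hall => ?_⟩
  · rw [hsum i]
    exact le_add_of_nonneg_right (Finset.sum_nonneg fun k _ => hnonneg i k)
  · simp only [hiff]
    constructor
    · intro h k hk
      have hq : 0 < N.arity k := by have := N.two_le_arity k; omega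
      -- The criterion for equality at `i` only sees sources held by `i`; the holder of the first
      -- qubit supplies such an `i`.
      obtain ⟨i, hi⟩ := Option.ne_none_iff_exists'.1 ((hall k hk).2 ⟨0, hq⟩)
      exact h i k hk (hall k hk).1 (hall k hk).2 (QNetwork.mem_parties.2 ⟨_, hi⟩)
    · exact fun h i k hk _ _ _ => h k hk
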